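/- **Setting.** Let $\Theta\subset\mathbb R^d$ be compact, let $\pi_0$ be a Borel probability measure on $\Theta$, let $T\ge 1$, and let $G_1,\dots,G_T:\Theta\to\mathbb R$ be measurable with $G_t(\theta)>0$ for all $\theta\in\Theta$ and $\sup_\Theta G_t<\infty$ (Assumption 1). Define probability measures on $\Theta$ by $$\pi_t(d\theta)=\pi_{t-1}(d\theta)\,\frac{G_t(\theta)}{\int_\Theta G_t\,d\pi_{t-1}},\qquad 1\le t\le T.$$ *Particle system.* For each $N\ge1$ let $\kappa=\kappa_N$ be a Markov kernel on $\Theta$ such that, for a constant $c_\kappa<\infty$ independent of $N$ and every bounded measurable $\varphi:\Theta\to\mathbb R$, $$\sup_{\theta'\in\Theta}\int_\Theta|\varphi(\theta)-\varphi(\theta')|\,\kappa_N(d\theta\mid\theta')\le \frac{c_\kappa\|\varphi\|_\infty}{\sqrt N}.$$ For each $N\ge 1$ the sampler with $N$ particles, $\Theta$-valued random variables on a common probability space (with any joint law across different $N$), is: $\theta_0^{(1)},\dots,\theta_0^{(N)}$ are i.i.d. with law $\pi_0$; for $t=1,\dots,T$, conditionally on the past, $\hat\theta_t^{(1)},\dots,\hat\theta_t^{(N)}$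 are independent with $\hat\theta_t^{(i)}\sim\kappa_N(\cdot\mid\theta_{t-1}^{(i)})$; then, conditionally on the past and on the $\hat\theta_t^{(i)}$, the particles $\theta_t^{(1)},\dots,\theta_t^{(N)}$ are i.i.d. with law $\sum_{i=1}^N w_t^{(i)}\delta_{\hat\theta_t^{(i)}}$, where $w_t^{(i)}=G_t(\hat\theta_t^{(i)})/\sum_{j=1}^N G_t(\hat\theta_t^{(j)})$. Put $\pi_t^N=\frac1N\sum_{i=1}^N\delta_{\theta_t^{(i)}}$. *Densities (Assumption 3).* For $1\le t\le T$ the measure $\pi_t$ has a probability density $\theta\mapsto\pi_t(\theta)$ with respect to Lebesgue measure on $\mathbb R^d$, a function $\mathbb R^d\to[0,\infty)$ that vanishes outside $\Theta$. For every $\alpha\in\{0,1\}^d$ the (two-sided, iterated) partial derivative $D^\alpha\pi_t(\theta)$ of this function on $\mathbb R^d$ exists at every $\theta\in\Theta$, boundary points included, and there is $L_{\alpha,t}>0$ with $|D^\alpha\pi_t(\theta)-D^\alpha\pi_t(\theta')|\le L_{\alpha,t}\|\theta-\theta'\|$ for all $\theta,\theta'\in\Theta$. *Kernel (Assumption 4).*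 $\mathsf k:\mathbb R^d\to[0,\infty)$ satisfies $\int\mathsf k(u)\,du=1$, $\int u\,\mathsf k(u)\,du=0$, $\int\|u\|^2\mathsf k(u)\,du<\infty$, and for every $\alpha\in\{0,1\}^d$ the derivative $D^\alpha\mathsf k$ exists on $\mathbb R^d$ and is continuous and bounded. For $h>0$ let $\mathsf k_h(u)=h^{-d}\mathsf k(h^{-1}u)$, and let $\mathsf p_t^N(\theta)=\int_\Theta\mathsf k_h(\theta-\theta')\,\pi_t^N(d\theta')$ with the bandwidth $$h=h(N)=\Big\lfloor N^{\frac1{2(d+1)}}\Big\rfloor^{-1}.$$ **Theorem.** For every $1\le t\le T$ and every $\varepsilon\in(0,1)$ there is an almost surely finite random variable $V_\varepsilon\ge0$, independent of $N$ and $\theta$ (i.e. one random variable serves all $N$ and $\theta$), such that for all $N\ge1$ $$\sup_{\theta\in\Theta}|\mathsf p_t^N(\theta)-\pi_t(\theta)|\le\frac{V_\varepsilon}{N^{\frac{1-\varepsilon}{2(d+1)}}}.$$ In particular, $\lim_{N\to\infty}\sup_{\theta\in\Theta}|\mathsf p_t^N(\theta)-\pi_t(\theta)|=0$ almost surely. 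-/

import Mathlib

open MeasureTheory ProbabilityTheory Filter Topology
open scoped ENNReal NNReal

namespace ParticleKDE

noncomputable section

/-- The parameter vectors live in `ℝ^d` with its Euclidean norm. -/
abbrev Vec (d : ℕ) : Type := EuclideanSpace ℝ (Fin d)

/-! ### Partial derivatives -/

/-- The partial derivative of `f` in the `i`-th coordinate. -/
def partialDeriv {d : ℕ} (i : Fin d) (f : Vec d → ℝ) : Vec d → ℝ :=
  fun x => lineDeriv ℝ f x (EuclideanSpace.single i 1)

/-- Iterated partial derivatives; the head of the list is the outermost derivative. -/
def mixedDeriv {d : ℕ} (f : Vec d → ℝ) : List (Fin d) → Vec d → ℝ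
  | [] => f
  | i :: l => partialDeriv i (mixedDeriv f l)

/-- The iterated partial derivative of `f` along the list exists at `x`: the inner derivative
exists near `x` and is differentiable at `x` in the outermost coordinate direction. -/
def MixedDerivExistsAt {d : ℕ} (f : Vec d → ℝ) : List (Fin d) → Vec d → Prop
  | [], _ => True
  | i :: l, x => (∀ᶠ y in 𝓝 x, MixedDerivExistsAt f l y) ∧
      LineDifferentiableAt ℝ (mixedDeriv f l) x (EuclideanSpace.single i 1)

/-- The list `0, …, 0, 1, …, 1, …` in which the coordinate `i` occurs `α i` times. -/
def multiIndexList {d : ℕ} (α : Fin d → ℕ) : List (Fin d) :=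
  (List.finRange d).flatMap fun i => List.replicate (α i) i

/-- The derivative `D^α f = ∂^{α_1} ⋯ ∂^{α_d} f / ∂θ_1^{α_1} ⋯ ∂θ_d^{α_d}`. -/
def multiDeriv {d : ℕ} (α : Fin d → ℕ) (f : Vec d → ℝ) : Vec d → ℝ :=
  mixedDeriv f (multiIndexList α)

/-- The derivative `D^α f` exists at the point `x`. -/
def MultiDerivExistsAt {d : ℕ} (α : Fin d → ℕ) (f : Vec d → ℝ) (x : Vec d) : Prop :=
  MixedDerivExistsAt f (multiIndexList α) x

/-! ### The sequence of target measures -/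

/-- The measures `π_0` and `π_t(dθ) = π_{t-1}(dθ) G_t(θ) / ∫ G_t dπ_{t-1}` for `t ≥ 1`. -/
def targetMeasure {S : Type*} [MeasurableSpace S] (π₀ : Measure S) (G : ℕ → S → ℝ) :
    ℕ → Measure S
  | 0 => π₀
  | t + 1 => (targetMeasure π₀ G t).withDensity fun θ =>
      ENNReal.ofReal (G (t + 1) θ / ∫ θ', G (t + 1) θ' ∂(targetMeasure π₀ G t))

/-- The potentials `G_1, …, G_T` are (measurable,) positive and bounded. -/
def PositiveBoundedPotentials {S : Type*} [MeasurableSpace S] (G : ℕ → S → ℝ) (T : ℕ) : Prop :=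
  ∀ t, 1 ≤ t → t ≤ T → Measurable (G t) ∧ (∀ θ, 0 < G t θ) ∧ ∃ C : ℝ, ∀ θ, G t θ ≤ C

/-- `p` is the probability density function with respect to Lebesgue measure on `ℝ^d` of the
measure `π` on `Θ ⊆ ℝ^d`; it vanishes outside `Θ`. -/
structure IsPdfOf {d : ℕ} {Θ : Set (Vec d)} (p : Vec d → ℝ) (π : Measure Θ) : Prop where
  measurable : Measurable p
  nonneg : ∀ θ, 0 ≤ p θ
  eq_zero : ∀ θ, θ ∉ Θ → p θ = 0
  map_eq : π.map (Subtype.val : Θ → Vec d) = volume.withDensity fun θ => ENNReal.ofReal (p θ)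

/-- For every `α ∈ {0,1}^d` the derivative `D^α p` exists at every point of `Θ` and is Lipschitz
continuous on `Θ`. -/
def LipschitzDerivsOn {d : ℕ} (Θ : Set (Vec d)) (p : Vec d → ℝ) : Prop :=
  ∀ α : Fin d → ℕ, (∀ i, α i ≤ 1) →
    (∀ θ ∈ Θ, MultiDerivExistsAt α p θ) ∧
    ∃ L : ℝ, 0 < L ∧ ∀ θ ∈ Θ, ∀ θ' ∈ Θ,
      |multiDeriv α p θ - multiDeriv α p θ'| ≤ L * ‖θ - θ'‖

/-! ### The particle system -/

/-- The jittering condition: `sup_{θ'} ∫ |φ(θ) - φ(θ')| κ_N(dθ | θ') ≤ c ‖φ‖_∞ / √N` for all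
bounded measurable `φ`, with a constant `c` that does not depend on `N`. -/
def JitteringBound {S : Type*} [MeasurableSpace S] (κ : ℕ → Kernel S S) : Prop :=
  ∃ c : ℝ, ∀ N : ℕ, 1 ≤ N → ∀ φ : S → ℝ, Measurable φ → (∃ C : ℝ, ∀ θ, |φ θ| ≤ C) →
    ∀ θ' : S, ∫ θ, |φ θ - φ θ'| ∂(κ N θ') ≤ c * (⨆ θ, |φ θ|) / Real.sqrt N

/-- The random measure `ν` is a version of the conditional distribution of `X` given the
σ-algebra `m`. -/
def HasCondLaw {Ω E : Type*} [MeasurableSpace Ω] [MeasurableSpace E] (μ : Measure Ω)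
    (m : MeasurableSpace Ω) (X : Ω → E) (ν : Ω → Measure E) : Prop :=
  ∀ B : Set E, MeasurableSet B →
    (Measurable[m] fun ω => ν ω B) ∧
    ∀ A : Set Ω, MeasurableSet[m] A → μ (A ∩ X ⁻¹' B) = ∫⁻ ω in A, ν ω B ∂μ

/-- The weighted measure `∑ i, w_i δ_{x_i}` with `w_i = g(x_i) / ∑ j, g(x_j)`. -/
def weightedMeasure {S : Type*} [MeasurableSpace S] {N : ℕ} (g : S → ℝ) (x : Fin N → S) :
    Measure S :=
  ∑ i, ENNReal.ofReal (g (x i) / ∑ j, g (x j)) • Measure.dirac (x i)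

/-- The σ-algebra generated by the particles `X_0, …, X_t` and the jittered particles
`Xhat_1, …, Xhat_t`. -/
@[reducible] def pastAlgebra {Ω S : Type*} [MeasurableSpace S] {N : ℕ} (X Xhat : ℕ → Ω → Fin N → S) (t : ℕ) :
    MeasurableSpace Ω :=
  (⨆ s ≤ t, MeasurableSpace.comap (X s) inferInstance) ⊔
    ⨆ s < t, MeasurableSpace.comap (Xhat (s + 1)) inferInstance

/-- `X_t` (`0 ≤ t ≤ T`) and `Xhat_t` (`1 ≤ t ≤ T`) are the particles and the jittered particles of
the sampler with `N` particles: the initial particles are i.i.d. with law `π₀`; given the past, the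
jittered particles are independent and the `i`-th one has law `κ(· | X_t^{(i)})`; given the past and
the jittered particles, the new particles are i.i.d. draws from the weighted jittered particles. -/
structure IsParticleSystem {Ω S : Type*} [MeasurableSpace Ω] [MeasurableSpace S] (μ : Measure Ω)
    (π₀ : Measure S) (κ : Kernel S S) (G : ℕ → S → ℝ) (T : ℕ) {N : ℕ}
    (X Xhat : ℕ → Ω → Fin N → S) : Prop where
  measurable_particles : ∀ t ≤ T, Measurable (X t)
  measurable_jittered : ∀ t < T, Measurable (Xhat (t + 1))
  init : μ.map (X 0) = Measure.pi fun _ => π₀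
  jitter : ∀ t < T, HasCondLaw μ (pastAlgebra X Xhat t) (Xhat (t + 1))
    fun ω => Measure.pi fun i => κ (X t ω i)
  resample : ∀ t < T, HasCondLaw μ
    (pastAlgebra X Xhat t ⊔ MeasurableSpace.comap (Xhat (t + 1)) inferInstance) (X (t + 1))
    fun ω => Measure.pi fun _ => weightedMeasure (G (t + 1)) (Xhat (t + 1) ω)

/-- The empirical measure `N⁻¹ ∑ i, δ_{x_i}`. -/
def empiricalMeasure {S : Type*} [MeasurableSpace S] {N : ℕ} (x : Fin N → S) : Measure S :=
  (N : ℝ≥0∞)⁻¹ • ∑ i, Measure.dirac (x i)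

/-! ### The kernel density estimator -/

/-- `k` is a zero-mean probability density on `ℝ^d` with finite second moment, whose derivatives
`D^α k`, `α ∈ {0,1}^d`, exist and are continuous and bounded. -/
structure IsSmoothingKernel {d : ℕ} (k : Vec d → ℝ) : Prop where
  nonneg : ∀ u, 0 ≤ k u
  integral_eq_one : ∫ u, k u = 1
  zero_mean : ∫ u, k u • u = 0
  second_moment : Integrable fun u => ‖u‖ ^ 2 * k u
  derivs : ∀ α : Fin d → ℕ, (∀ i, α i ≤ 1) →
    (∀ u, MultiDerivExistsAt α k u) ∧ Continuous (multiDeriv α k) ∧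
    ∃ C : ℝ, ∀ u, |multiDeriv α k u| ≤ C

/-- The scaled kernel `k_h(u) = h^{-d} k(h^{-1} u)`. -/
def scaledKernel {d : ℕ} (k : Vec d → ℝ) (h : ℝ) (u : Vec d) : ℝ :=
  (h ^ d)⁻¹ * k (h⁻¹ • u)

/-- The bandwidth `h(N) = ⌊N^{1/(2(d+1))}⌋^{-1}`. -/
def bandwidth (d N : ℕ) : ℝ :=
  ((⌊(N : ℝ) ^ (1 / (2 * ((d : ℝ) + 1)))⌋ : ℤ) : ℝ)⁻¹

/-- The kernel density estimator `θ ↦ ∫ k_h(θ - θ') π^N(dθ')`, where `π^N` is the empirical measure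
of the `N` particles `x` and `h = h(N)`. -/
def kde {d : ℕ} {Θ : Set (Vec d)} (k : Vec d → ℝ) {N : ℕ} (x : Fin N → Θ) (θ : Vec d) : ℝ :=
  ∫ θ' : Θ, scaledKernel k (bandwidth d N) (θ - (θ' : Vec d)) ∂(empiricalMeasure x)

/-- The supremum over `θ ∈ Θ` of `|f θ - g θ|`, as an element of `[0, ∞]`. -/
def supDist {d : ℕ} (Θ : Set (Vec d)) (f g : Vec d → ℝ) : ℝ≥0∞ :=
  ⨆ θ ∈ Θ, ENNReal.ofReal |f θ - g θ|

end

end ParticleKDE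

namespace ParticleKDE

/-- The average of `φ` over the points `x`. -/
noncomputable def empiricalMean {S : Type*} {N : ℕ} (φ : S → ℝ) (x : Fin N → S) : ℝ :=
  (N : ℝ)⁻¹ * ∑ i, φ (x i)

theorem measurable_empiricalMean {S : Type*} [MeasurableSpace S] {N : ℕ} {φ : S → ℝ}
    (hφ : Measurable φ) : Measurable (empiricalMean φ : (Fin N → S) → ℝ) := by
  unfold empiricalMean
  fun_prop

theorem integrable_of_abs_le {S : Type*} [MeasurableSpace S] {ν : Measure S} [IsFiniteMeasure ν]
    {φ : S → ℝ} (hφ : Measurable φ) {B : ℝ} (hB : ∀ x, |φ x| ≤ B) : Integrable φ ν :=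
  Integrable.of_bound hφ.aestronglyMeasurable B (ae_of_all _ hB)

theorem integral_empiricalMean_pi {S : Type*} [MeasurableSpace S] {N : ℕ} (ν : Fin N → Measure S)
    [∀ i, IsProbabilityMeasure (ν i)] {φ : S → ℝ} (hφ : Measurable φ) {B : ℝ}
    (hB : ∀ x, |φ x| ≤ B) :
    ∫ y, empiricalMean φ y ∂(Measure.pi ν) = (N : ℝ)⁻¹ * ∑ i, ∫ x, φ x ∂(ν i) := by
  unfold empiricalMean
  rw [integral_const_mul, integral_finsetSum]
  · congr 1
    refine Finset.sum_congr rfl fun i _ => ?_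
    exact integral_comp_eval (μ := ν) hφ.aestronglyMeasurable
  · intro i _
    exact integrable_of_abs_le (by fun_prop) fun y => hB (y i)

/-- Hoeffding's inequality for the mean of a bounded function of independent variables. -/
theorem hoeffding_pi {S : Type*} [MeasurableSpace S] {N : ℕ} (hN : 1 ≤ N) (ν : Fin N → Measure S)
    [∀ i, IsProbabilityMeasure (ν i)] {φ : S → ℝ} (hφ : Measurable φ) {B : ℝ} (hB0 : 0 < B)
    (hB : ∀ x, |φ x| ≤ B) {s : ℝ} (hs : 0 ≤ s) :
    (Measure.pi ν).real
      {y | s * B ≤ |empiricalMean φ y - ∫ y, empiricalMean φ y ∂(Measure.pi ν)|} ≤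
        2 * Real.exp (-(1 / 2 * N * s ^ 2)) := by
  have hN0 : (0 : ℝ) < N := by exact_mod_cast hN
  have key : ∀ ψ : S → ℝ, Measurable ψ → (∀ x, |ψ x| ≤ B) →
      (Measure.pi ν).real {y | s * B * N ≤ ∑ i, (ψ (y i) - ∫ x, ψ x ∂(ν i))} ≤
        Real.exp (-(1 / 2 * N * s ^ 2)) := by
    intro ψ hψ hψB
    have hind : iIndepFun (fun i (y : Fin N → S) => ψ (y i) - ∫ x, ψ x ∂(ν i)) (Measure.pi ν) :=
      iIndepFun_pi (X := fun i x => ψ x - ∫ x, ψ x ∂(ν i)) fun i => by fun_prop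
    have hsub : ∀ i ∈ Finset.univ, HasSubgaussianMGF
        (fun (y : Fin N → S) => ψ (y i) - ∫ x, ψ x ∂(ν i)) ((‖B - (-B)‖₊ / 2) ^ 2)
        (Measure.pi ν) := by
      intro i _
      have h := hasSubgaussianMGF_of_mem_Icc (μ := Measure.pi ν)
        (X := fun y : Fin N → S => ψ (y i)) (a := -B) (b := B)
        (hψ.comp (measurable_pi_apply i)).aemeasurable
        (ae_of_all _ fun y => abs_le.1 (hψB (y i)))
      rwa [integral_comp_eval (μ := ν) hψ.aestronglyMeasurable] at h
    refine (HasSubgaussianMGF.measure_sum_ge_le_of_iIndepFun hind hsub (by positivity)).trans ?_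
    apply Real.exp_le_exp.2
    apply le_of_eq
    have : ‖B - -B‖ = 2 * B := by
      rw [Real.norm_eq_abs, abs_of_pos (by linarith)]; ring
    simp only [Finset.sum_const, Finset.card_univ, Fintype.card_fin, nsmul_eq_mul]
    push_cast
    rw [this]
    field_simp
  rw [integral_empiricalMean_pi ν hφ hB]
  have hsubset : {y : Fin N → S | s * B ≤ |empiricalMean φ y - (N : ℝ)⁻¹ * ∑ i, ∫ x, φ x ∂(ν i)|} ⊆
      {y | s * B * N ≤ ∑ i, (φ (y i) - ∫ x, φ x ∂(ν i))} ∪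
      {y | s * B * N ≤ ∑ i, ((fun x => -φ x) (y i) - ∫ x, (fun x => -φ x) x ∂(ν i))} := by
    intro y hy
    have e : empiricalMean φ y - (N : ℝ)⁻¹ * ∑ i, ∫ x, φ x ∂(ν i) =
        (∑ i, (φ (y i) - ∫ x, φ x ∂(ν i))) / N := by
      rw [empiricalMean, Finset.sum_sub_distrib]; ring
    rw [Set.mem_ofPred_eq, e, abs_div, abs_of_pos hN0, le_div_iff₀ hN0] at hy
    rcases le_abs.1 hy with h | h
    · exact Or.inl h
    · right
      simp only [Set.mem_ofPred_eq, integral_neg, Finset.sum_sub_distrib, Finset.sum_neg_distrib]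
        at h ⊢
      linarith
  calc _ ≤ _ := measureReal_mono hsubset
    _ ≤ _ := measureReal_union_le _ _
    _ ≤ _ := by
      have h1 := key φ hφ hB
      have h2 := key (fun x => -φ x) hφ.neg (by simpa using hB)
      linarith

/-! ### Conditional laws -/

theorem map_prodMk_eq_compProd {Ω Ω' E : Type*} [MeasurableSpace Ω] [MeasurableSpace Ω']
    [MeasurableSpace E] {μ : Measure Ω} [IsProbabilityMeasure μ] {Z : Ω → Ω'} (hZ : Measurable Z)
    {Y : Ω → E} (hY : Measurable Y) (ν : Kernel Ω' E) [IsMarkovKernel ν]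
    (h : ∀ A B, MeasurableSet A → MeasurableSet B →
      μ (Z ⁻¹' A ∩ Y ⁻¹' B) = ∫⁻ ω in Z ⁻¹' A, ν (Z ω) B ∂μ) :
    μ.map (fun ω => (Z ω, Y ω)) = (μ.map Z) ⊗ₘ ν := by
  have := Measure.isProbabilityMeasure_map (μ := μ) hZ.aemeasurable
  have := Measure.isProbabilityMeasure_map (μ := μ) (hZ.prodMk hY).aemeasurable
  refine Measure.ext_prod fun {A B} hA hB => ?_
  rw [Measure.map_apply (hZ.prodMk hY) (hA.prod hB), Measure.compProd_apply_prod hA hB,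
    setLIntegral_map hA (ν.measurable_coe hB) hZ, ← h A B hA hB]
  rfl

theorem measureReal_tail_le_of_kernel {Ω Ω' E : Type*} [MeasurableSpace Ω] [MeasurableSpace Ω']
    [MeasurableSpace E] {μ : Measure Ω} [IsProbabilityMeasure μ] {Z : Ω → Ω'} (hZ : Measurable Z)
    {Y : Ω → E} (hY : Measurable Y) (ν : Kernel Ω' E) [IsMarkovKernel ν]
    (h : ∀ A B, MeasurableSet A → MeasurableSet B →
      μ (Z ⁻¹' A ∩ Y ⁻¹' B) = ∫⁻ ω in Z ⁻¹' A, ν (Z ω) B ∂μ)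
    {F : E → ℝ} (hF : Measurable F) {r c : ℝ} (hc0 : 0 ≤ c)
    (hc : ∀ z, (ν z).real {y | r ≤ |F y - ∫ y, F y ∂(ν z)|} ≤ c) :
    μ.real {ω | r ≤ |F (Y ω) - ∫ y, F y ∂(ν (Z ω))|} ≤ c := by
  have := Measure.isProbabilityMeasure_map (μ := μ) hZ.aemeasurable
  have hI : Measurable fun z => ∫ y, F y ∂(ν z) :=
    (StronglyMeasurable.integral_kernel (κ := ν) hF.stronglyMeasurable).measurable
  have hs : MeasurableSet {q : Ω' × E | r ≤ |F q.2 - ∫ y, F y ∂(ν q.1)|} :=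
    measurableSet_le measurable_const
      ((hF.comp measurable_snd).sub (hI.comp measurable_fst)).abs
  have e : μ {ω | r ≤ |F (Y ω) - ∫ y, F y ∂(ν (Z ω))|} =
      ((μ.map Z) ⊗ₘ ν) {q : Ω' × E | r ≤ |F q.2 - ∫ y, F y ∂(ν q.1)|} := by
    rw [← map_prodMk_eq_compProd hZ hY ν h, Measure.map_apply (hZ.prodMk hY) hs]
    rfl
  rw [measureReal_def, e, Measure.compProd_apply hs]
  refine ENNReal.toReal_le_of_le_ofReal hc0 ?_
  calc _ ≤ ∫⁻ _, ENNReal.ofReal c ∂(μ.map Z) := by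
        refine lintegral_mono fun z => ?_
        rw [ENNReal.le_ofReal_iff_toReal_le (measure_ne_top _ _) hc0]
        exact hc z
    _ = _ := by simp

theorem HasCondLaw.measureReal_tail_le {Ω E : Type*} {m mΩ : MeasurableSpace Ω} [MeasurableSpace E]
    {μ : Measure Ω} [IsProbabilityMeasure μ] (hm : m ≤ mΩ)
    {Y : Ω → E} (hY : Measurable Y) {ν : Ω → Measure E} [∀ ω, IsProbabilityMeasure (ν ω)]
    (h : HasCondLaw μ m Y ν) {F : E → ℝ} (hF : Measurable F) {r c : ℝ} (hc0 : 0 ≤ c)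
    (hc : ∀ ω, (ν ω).real {y | r ≤ |F y - ∫ y, F y ∂(ν ω)|} ≤ c) :
    μ.real {ω | r ≤ |F (Y ω) - ∫ y, F y ∂(ν ω)|} ≤ c := by
  let K : @Kernel Ω E m _ := @Kernel.mk Ω E m _ ν
    (@Measure.measurable_of_measurable_coe _ _ _ m _ fun B hB => (h B hB).1)
  have hK : @IsMarkovKernel Ω E m _ K := @IsMarkovKernel.mk Ω E m _ K inferInstance
  exact @measureReal_tail_le_of_kernel Ω Ω E mΩ m _ μ _ id (measurable_id'' hm) Y hY K hK
    (fun A B hA hB => (h B hB).2 A hA) F hF r c hc0 hc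

/-! ### Concentration of empirical means -/

/-- Sub-Gaussian concentration, at the scale `N^{-1/2}`, of the empirical means of bounded functions
of the random points `Y` around their integrals with respect to `π`. -/
def Concentrates {Ω S : Type*} [MeasurableSpace Ω] [MeasurableSpace S] (μ : Measure Ω) {N : ℕ}
    (Y : Ω → Fin N → S) (π : Measure S) (a b : ℝ) : Prop :=
  ∀ φ : S → ℝ, Measurable φ → ∀ B, 0 < B → (∀ x, |φ x| ≤ B) → ∀ s, 0 ≤ s →
    μ.real {ω | s * B ≤ |empiricalMean φ (Y ω) - ∫ x, φ x ∂π|} ≤ a * Real.exp (-(b * N * s ^ 2))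

theorem exp_tail_le {N : ℕ} {b b' s s' : ℝ} (h : b' * s' ^ 2 ≤ b * s ^ 2) :
    Real.exp (-(b * N * s ^ 2)) ≤ Real.exp (-(b' * N * s' ^ 2)) := by
  apply Real.exp_le_exp.2
  have : (0 : ℝ) ≤ N := N.cast_nonneg
  nlinarith

theorem concentrates_of_map_eq_pi {Ω S : Type*} [MeasurableSpace Ω] [MeasurableSpace S]
    {μ : Measure Ω} {N : ℕ} (hN : 1 ≤ N) {Y : Ω → Fin N → S} (hY : Measurable Y) {π : Measure S}
    [IsProbabilityMeasure π] (h : μ.map Y = Measure.pi fun _ => π) :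
    Concentrates μ Y π 2 (1 / 2) := by
  intro φ hφ B hB0 hB s hs
  have hN0 : (N : ℝ) ≠ 0 := by positivity
  have h1 := hoeffding_pi hN (fun _ => π) hφ hB0 hB hs
  rw [integral_empiricalMean_pi _ hφ hB, ← h, measureReal_def, Measure.map_apply hY] at h1
  · simpa [hN0, measureReal_def] using h1
  · exact measurableSet_le measurable_const
      ((measurable_empiricalMean hφ).sub_const _).abs

theorem Concentrates.jitter {Ω S : Type*} {m mΩ : MeasurableSpace Ω} [MeasurableSpace S]
    {μ : Measure Ω} [IsProbabilityMeasure μ] (hm : m ≤ mΩ) {N : ℕ} (hN : 1 ≤ N)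
    {κ : Kernel S S} [IsMarkovKernel κ] {c : ℝ}
    (hκ : ∀ φ : S → ℝ, Measurable φ → (∃ C : ℝ, ∀ θ, |φ θ| ≤ C) →
      ∀ θ' : S, ∫ θ, |φ θ - φ θ'| ∂(κ θ') ≤ c * (⨆ θ, |φ θ|) / Real.sqrt N)
    {X Y : Ω → Fin N → S} (hY : Measurable Y)
    (h : HasCondLaw μ m Y fun ω => Measure.pi fun i => κ (X ω i))
    {π : Measure S} {a b : ℝ} (ha : 0 ≤ a) (hb : 0 ≤ b) (hX : Concentrates μ X π a b) :
    Concentrates μ Y π ((2 + a) * Real.exp (min (1 / 2) b * c ^ 2)) (min (1 / 2) b / 9) := by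
  intro φ hφ B hB0 hB s hs
  have hN0 : (0 : ℝ) < N := by exact_mod_cast hN
  have hsq : 0 < Real.sqrt N := Real.sqrt_pos.2 hN0
  set β := min (1 / 2) b with hβ
  have hβ0 : 0 ≤ β := le_min (by norm_num) hb
  have hκ' : ∀ x, |∫ θ, φ θ ∂(κ x) - φ x| ≤ |c| * B / Real.sqrt N := by
    intro x
    have : Nonempty S := ⟨x⟩
    have hi := integrable_of_abs_le (ν := κ x) hφ hB
    calc |∫ θ, φ θ ∂(κ x) - φ x| = |∫ θ, (φ θ - φ x) ∂(κ x)| := by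
          rw [integral_sub hi (integrable_const _)]; simp
      _ ≤ ∫ θ, |φ θ - φ x| ∂(κ x) := abs_integral_le_integral_abs
      _ ≤ c * (⨆ θ, |φ θ|) / Real.sqrt N := hκ φ hφ ⟨B, hB⟩ x
      _ ≤ |c| * B / Real.sqrt N := by
          gcongr
          · exact Real.iSup_nonneg fun _ => abs_nonneg _
          · exact le_abs_self c
          · exact ciSup_le hB
  rcases le_or_gt (s * Real.sqrt N) (3 * |c|) with hsmall | hlarge
  · refine measureReal_le_one.trans ?_
    have h1 : N * s ^ 2 ≤ 9 * c ^ 2 := by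
      have h2 := pow_le_pow_left₀ (by positivity) hsmall 2
      rw [mul_pow, mul_pow, Real.sq_sqrt hN0.le, sq_abs] at h2
      linarith
    rw [mul_assoc, ← Real.exp_add]
    have : 1 ≤ Real.exp (β * c ^ 2 + -(β / 9 * N * s ^ 2)) := Real.one_le_exp (by nlinarith)
    nlinarith
  · have hd : |c| * B / Real.sqrt N ≤ s / 3 * B := by
      rw [div_le_iff₀ hsq]
      nlinarith
    have hsubset : {ω | s * B ≤ |empiricalMean φ (Y ω) - ∫ x, φ x ∂π|} ⊆
        {ω | s / 3 * B ≤ |empiricalMean φ (Y ω) -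
          ∫ y, empiricalMean φ y ∂(Measure.pi fun i => κ (X ω i))|} ∪
        {ω | s / 3 * B ≤ |empiricalMean φ (X ω) - ∫ x, φ x ∂π|} := by
      intro ω hω
      by_contra hcon
      simp only [Set.mem_union, Set.mem_ofPred_eq, not_or, not_le] at hcon hω
      obtain ⟨h1, h2⟩ := hcon
      rw [integral_empiricalMean_pi _ hφ hB] at h1
      have h3 : |(N : ℝ)⁻¹ * ∑ i, ∫ x, φ x ∂(κ (X ω i)) - empiricalMean φ (X ω)| ≤ s / 3 * B := by
        rw [empiricalMean, ← mul_sub, ← Finset.sum_sub_distrib, abs_mul,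
          abs_of_pos (inv_pos.2 hN0), inv_mul_le_iff₀ hN0]
        calc _ ≤ _ := Finset.abs_sum_le_sum_abs _ _
          _ ≤ ∑ _i : Fin N, s / 3 * B := Finset.sum_le_sum fun i _ => (hκ' _).trans hd
          _ = _ := by simp
      have h4 := abs_add_three
        (empiricalMean φ (Y ω) - (N : ℝ)⁻¹ * ∑ i, ∫ x, φ x ∂(κ (X ω i)))
        ((N : ℝ)⁻¹ * ∑ i, ∫ x, φ x ∂(κ (X ω i)) - empiricalMean φ (X ω))
        (empiricalMean φ (X ω) - ∫ x, φ x ∂π)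
      rw [sub_add_sub_cancel, sub_add_sub_cancel] at h4
      linarith
    have e1 := h.measureReal_tail_le hm hY (measurable_empiricalMean hφ)
      (r := s / 3 * B) (by positivity)
      fun ω => hoeffding_pi hN (fun i => κ (X ω i)) hφ hB0 hB (s := s / 3) (by positivity)
    have e2 := hX φ hφ B hB0 hB (s / 3) (by positivity)
    have f1 : Real.exp (-(1 / 2 * N * (s / 3) ^ 2)) ≤ Real.exp (-(β / 9 * N * s ^ 2)) :=
      exp_tail_le (by nlinarith [min_le_left (1 / 2) b, sq_nonneg s])
    have f2 : Real.exp (-(b * N * (s / 3) ^ 2)) ≤ Real.exp (-(β / 9 * N * s ^ 2)) :=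
      exp_tail_le (by nlinarith [min_le_right (1 / 2) b, sq_nonneg s])
    calc _ ≤ _ := (measureReal_mono hsubset).trans (measureReal_union_le _ _)
      _ ≤ (2 + a) * Real.exp (-(β / 9 * N * s ^ 2)) := by nlinarith
      _ ≤ _ := by
        gcongr
        exact le_mul_of_one_le_right (by positivity) (Real.one_le_exp (by positivity))

/-! ### Reweighting and resampling -/

theorem isProbabilityMeasure_weightedMeasure {S : Type*} [MeasurableSpace S] {N : ℕ} (hN : 1 ≤ N)
    {g : S → ℝ} (hg : ∀ x, 0 < g x) (x : Fin N → S) :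
    IsProbabilityMeasure (weightedMeasure g x) := by
  have : Nonempty (Fin N) := ⟨⟨0, hN⟩⟩
  have hpos : 0 < ∑ j, g (x j) := Finset.sum_pos (fun j _ => hg _) Finset.univ_nonempty
  constructor
  simp only [weightedMeasure, Measure.finsetSum_apply, Measure.smul_apply, measure_univ,
    smul_eq_mul, mul_one]
  rw [← ENNReal.ofReal_sum_of_nonneg fun i _ => div_nonneg (hg _).le hpos.le, ← Finset.sum_div,
    div_self hpos.ne', ENNReal.ofReal_one]

theorem integral_weightedMeasure {S : Type*} [MeasurableSpace S] {N : ℕ} (hN : 1 ≤ N)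
    {g : S → ℝ} (hg : ∀ x, 0 < g x) (x : Fin N → S) {φ : S → ℝ} (hφ : Measurable φ) {B : ℝ}
    (hB : ∀ x, |φ x| ≤ B) :
    ∫ y, φ y ∂(weightedMeasure g x) =
      empiricalMean (fun y => g y * φ y) x / empiricalMean g x := by
  have hN0 : (N : ℝ)⁻¹ ≠ 0 := by positivity
  have hpos : 0 ≤ ∑ j, g (x j) := Finset.sum_nonneg fun j _ => (hg _).le
  rw [weightedMeasure, integral_finsetSum_measure]
  · simp only [integral_smul_measure, empiricalMean]
    rw [mul_div_mul_left _ _ hN0, Finset.sum_div]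
    refine Finset.sum_congr rfl fun i _ => ?_
    rw [integral_dirac' _ _ hφ.stronglyMeasurable,
      ENNReal.toReal_ofReal (div_nonneg (hg _).le hpos), smul_eq_mul]
    ring
  · intro i _
    exact (integrable_of_abs_le hφ hB).smul_measure ENNReal.ofReal_ne_top

theorem abs_ratio_sub_le {A D u g B : ℝ} (hg : 0 < g) (hD : 0 < D) (hAD : |A| ≤ B * D) :
    |A / D - u / g| ≤ B * |D - g| / g + |A - u| / g := by
  have e : A / D - u / g = A / D * ((g - D) / g) + (A - u) / g := by field_simp; ring
  have h1 : |A / D| ≤ B := by rwa [abs_div, abs_of_pos hD, div_le_iff₀ hD]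
  calc |A / D - u / g| ≤ |A / D| * (|g - D| / g) + |A - u| / g := by
        rw [e]
        refine (abs_add_le _ _).trans ?_
        rw [abs_mul, abs_div (g - D), abs_div (A - u), abs_of_pos hg]
    _ ≤ B * (|g - D| / g) + |A - u| / g := by gcongr
    _ = _ := by rw [abs_sub_comm, mul_div_assoc]

theorem Concentrates.resample {Ω S : Type*} {m mΩ : MeasurableSpace Ω} [MeasurableSpace S]
    {μ : Measure Ω} [IsProbabilityMeasure μ] (hm : m ≤ mΩ) {N : ℕ} (hN : 1 ≤ N)
    {g : S → ℝ} (hgm : Measurable g) (hg : ∀ x, 0 < g x) {C : ℝ} (hC0 : 0 < C)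
    (hC : ∀ x, g x ≤ C)
    {X Y : Ω → Fin N → S} (hY : Measurable Y)
    (h : HasCondLaw μ m Y fun ω => Measure.pi fun _ => weightedMeasure g (X ω))
    {π π' : Measure S} [IsProbabilityMeasure π] (hγ : 0 < ∫ x, g x ∂π)
    (hπ' : ∀ φ : S → ℝ, ∫ x, φ x ∂π' = (∫ x, g x * φ x ∂π) / ∫ x, g x ∂π)
    {a b : ℝ} (ha : 0 ≤ a) (hX : Concentrates μ X π a b) :
    Concentrates μ Y π' (2 + 2 * a)
      (min (1 / 8) (b * ((∫ x, g x ∂π) / (4 * C)) ^ 2)) := by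
  intro φ hφ B hB0 hB s hs
  have hN0 : (0 : ℝ) < N := by exact_mod_cast hN
  have : Nonempty (Fin N) := ⟨⟨0, hN⟩⟩
  have hprob := fun ω => isProbabilityMeasure_weightedMeasure hN hg (X ω)
  set γ := ∫ x, g x ∂π with hγdef
  set β := min (1 / 8) (b * (γ / (4 * C)) ^ 2) with hβ
  have hgC : ∀ x, |g x| ≤ C := fun x => by rw [abs_of_pos (hg x)]; exact hC x
  have hgφ : ∀ x, |g x * φ x| ≤ C * B := fun x => by
    rw [abs_mul]; exact mul_le_mul (hgC x) (hB x) (abs_nonneg _) hC0.le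
  have hsubset : {ω | s * B ≤ |empiricalMean φ (Y ω) - ∫ x, φ x ∂π'|} ⊆
      {ω | s / 2 * B ≤ |empiricalMean φ (Y ω) -
        ∫ y, empiricalMean φ y ∂(Measure.pi fun _ : Fin N => weightedMeasure g (X ω))|} ∪
      ({ω | s * (γ / (4 * C)) * C ≤ |empiricalMean g (X ω) - ∫ x, g x ∂π|} ∪
      {ω | s * (γ / (4 * C)) * (C * B) ≤
        |empiricalMean (fun x => g x * φ x) (X ω) - ∫ x, g x * φ x ∂π|}) := by
    intro ω hω
    by_contra hcon
    simp only [Set.mem_union, Set.mem_ofPred_eq, not_or, not_le] at hcon hω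
    obtain ⟨h1, h2, h3⟩ := hcon
    rw [integral_empiricalMean_pi _ hφ hB] at h1
    simp only [Finset.sum_const, Finset.card_univ, Fintype.card_fin, nsmul_eq_mul] at h1
    rw [inv_mul_cancel_left₀ hN0.ne', integral_weightedMeasure hN hg (X ω) hφ hB] at h1
    have hD : 0 < empiricalMean g (X ω) :=
      mul_pos (inv_pos.2 hN0) (Finset.sum_pos (fun j _ => hg _) Finset.univ_nonempty)
    have hAD : |empiricalMean (fun x => g x * φ x) (X ω)| ≤ B * empiricalMean g (X ω) := by
      rw [empiricalMean, empiricalMean, abs_mul, abs_of_pos (inv_pos.2 hN0), mul_left_comm,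
        Finset.mul_sum]
      refine mul_le_mul_of_nonneg_left ?_ (inv_pos.2 hN0).le
      refine (Finset.abs_sum_le_sum_abs _ _).trans (Finset.sum_le_sum fun i _ => ?_)
      rw [abs_mul, abs_of_pos (hg _), mul_comm]
      exact mul_le_mul_of_nonneg_right (hB _) (hg _).le
    have h4 := abs_ratio_sub_le (u := ∫ x, g x * φ x ∂π) hγ hD hAD
    have h5 : B * |empiricalMean g (X ω) - γ| / γ < s / 4 * B := by
      rw [div_lt_iff₀ hγ]
      have : s * (γ / (4 * C)) * C = s / 4 * γ := by field_simp
      rw [this] at h2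
      nlinarith
    have h6 : |empiricalMean (fun x => g x * φ x) (X ω) - ∫ x, g x * φ x ∂π| / γ
        < s / 4 * B := by
      rw [div_lt_iff₀ hγ]
      have : s * (γ / (4 * C)) * (C * B) = s / 4 * B * γ := by field_simp
      rwa [this] at h3
    have h7 := abs_sub_le (empiricalMean φ (Y ω))
      (empiricalMean (fun x => g x * φ x) (X ω) / empiricalMean g (X ω)) (∫ x, φ x ∂π')
    rw [← hπ' φ] at h4
    linarith
  have e1 := h.measureReal_tail_le hm hY (measurable_empiricalMean hφ)
    (r := s / 2 * B) (by positivity)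
    fun ω => hoeffding_pi hN (fun _ => weightedMeasure g (X ω)) hφ hB0 hB (s := s / 2)
      (by positivity)
  have e2 := hX g hgm C hC0 hgC (s * (γ / (4 * C))) (by positivity)
  have e3 := hX (fun x => g x * φ x) (hgm.mul hφ) (C * B) (by positivity) hgφ (s * (γ / (4 * C))) (by positivity)
  have f1 : Real.exp (-(1 / 2 * N * (s / 2) ^ 2)) ≤ Real.exp (-(β * N * s ^ 2)) :=
    exp_tail_le (by nlinarith [min_le_left (1 / 8) (b * (γ / (4 * C)) ^ 2), sq_nonneg s])
  have f2 : Real.exp (-(b * N * (s * (γ / (4 * C))) ^ 2)) ≤ Real.exp (-(β * N * s ^ 2)) :=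
    exp_tail_le (by
      rw [mul_pow, mul_left_comm, mul_comm (s ^ 2)]
      exact mul_le_mul_of_nonneg_right (min_le_right _ _) (sq_nonneg s))
  calc _ ≤ _ := (measureReal_mono hsubset).trans (measureReal_union_le _ _)
    _ ≤ _ := add_le_add_right (measureReal_union_le _ _) _
    _ ≤ (2 + 2 * a) * Real.exp (-(β * N * s ^ 2)) := by
      have g2 := e2.trans (mul_le_mul_of_nonneg_left f2 ha)
      have g3 := e3.trans (mul_le_mul_of_nonneg_left f2 ha)
      linarith

/-! ### The target measures and the particle system -/

theorem integral_pos_of_pos {S : Type*} [MeasurableSpace S] {π : Measure S}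
    [IsProbabilityMeasure π] {g : S → ℝ} (hg : ∀ x, 0 < g x) (hi : Integrable g π) :
    0 < ∫ x, g x ∂π := by
  rw [integral_pos_iff_support_of_nonneg (fun x => (hg x).le) hi]
  have : Function.support g = Set.univ := Set.eq_univ_of_forall fun x => (hg x).ne'
  simp [this]

theorem integral_targetMeasure_succ {S : Type*} [MeasurableSpace S] {π₀ : Measure S}
    {G : ℕ → S → ℝ} {t : ℕ} (hGm : Measurable (G (t + 1))) (hG : ∀ x, 0 < G (t + 1) x)
    (φ : S → ℝ) :
    ∫ x, φ x ∂(targetMeasure π₀ G (t + 1)) =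
      (∫ x, G (t + 1) x * φ x ∂(targetMeasure π₀ G t)) /
        ∫ x, G (t + 1) x ∂(targetMeasure π₀ G t) := by
  rw [targetMeasure, integral_withDensity_eq_integral_toReal_smul
    (hGm.div_const _).ennreal_ofReal (ae_of_all _ fun _ => ENNReal.ofReal_lt_top),
    ← integral_div]
  refine integral_congr_ae (ae_of_all _ fun x => ?_)
  dsimp only
  rw [ENNReal.toReal_ofReal (div_nonneg (hG x).le (integral_nonneg fun y => (hG y).le)),
    smul_eq_mul]
  ring

theorem isProbabilityMeasure_targetMeasure {S : Type*} [MeasurableSpace S] {π₀ : Measure S}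
    [IsProbabilityMeasure π₀] {G : ℕ → S → ℝ} {T : ℕ} (hG : PositiveBoundedPotentials G T)
    {t : ℕ} (ht : t ≤ T) : IsProbabilityMeasure (targetMeasure π₀ G t) := by
  induction t with
  | zero => assumption
  | succ t ih =>
    have := ih (by omega)
    obtain ⟨hGm, hpos, C, hC⟩ := hG (t + 1) (by omega) ht
    have hi : Integrable (G (t + 1)) (targetMeasure π₀ G t) :=
      integrable_of_abs_le hGm (B := C) fun x => by rw [abs_of_pos (hpos x)]; exact hC x
    have hγ := integral_pos_of_pos hpos hi
    constructor
    rw [targetMeasure, withDensity_apply _ MeasurableSet.univ, Measure.restrict_univ,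
      ← ofReal_integral_eq_lintegral_ofReal (hi.div_const _)
        (ae_of_all _ fun x => div_nonneg (hpos x).le hγ.le),
      integral_div, div_self hγ.ne', ENNReal.ofReal_one]

theorem pastAlgebra_le {Ω S : Type*} {mΩ : MeasurableSpace Ω} [MeasurableSpace S] {N T t : ℕ}
    {X Xhat : ℕ → Ω → Fin N → S} (hX : ∀ t ≤ T, Measurable (X t))
    (hXhat : ∀ t < T, Measurable (Xhat (t + 1))) (ht : t ≤ T) : pastAlgebra X Xhat t ≤ mΩ := by
  refine sup_le (iSup₂_le fun s hs => ?_) (iSup₂_le fun s hs => ?_)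
  · exact (hX s (hs.trans ht)).comap_le
  · exact (hXhat s (hs.trans_le ht)).comap_le

/-- The particles concentrate around the target measures, with constants that do not depend on the
number of particles. -/
theorem exists_concentrates {Ω S : Type*} [MeasurableSpace Ω] [MeasurableSpace S] {μ : Measure Ω}
    [IsProbabilityMeasure μ] {T : ℕ} {π₀ : Measure S} [IsProbabilityMeasure π₀] {G : ℕ → S → ℝ}
    (hG : PositiveBoundedPotentials G T) {κ : ℕ → Kernel S S} [∀ N, IsMarkovKernel (κ N)]
    (hκ : JitteringBound κ) {X Xhat : (N : ℕ) → ℕ → Ω → Fin N → S}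
    (hX : ∀ N, 1 ≤ N → IsParticleSystem μ π₀ (κ N) G T (X N) (Xhat N)) {t : ℕ} (ht : t ≤ T) :
    ∃ a b : ℝ, 0 < a ∧ 0 < b ∧
      ∀ N, 1 ≤ N → Concentrates μ (X N t) (targetMeasure π₀ G t) a b := by
  induction t with
  | zero =>
    have := isProbabilityMeasure_targetMeasure (π₀ := π₀) hG ht
    refine ⟨2, 1 / 2, by norm_num, by norm_num, fun N hN => ?_⟩
    obtain ⟨hm, -, hlaw, -, -⟩ := hX N hN
    exact concentrates_of_map_eq_pi hN (hm 0 ht) hlaw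
  | succ t ih =>
    obtain ⟨a, b, ha, hb, hab⟩ := ih (by omega)
    obtain ⟨c, hc⟩ := hκ
    obtain ⟨hGm, hpos, C, hC⟩ := hG (t + 1) (by omega) ht
    have := isProbabilityMeasure_targetMeasure (π₀ := π₀) hG (t := t) (by omega)
    have hC' : ∀ x, G (t + 1) x ≤ max C 1 := fun x => (hC x).trans (le_max_left _ _)
    have hC0 : 0 < max C 1 := lt_max_of_lt_right one_pos
    have hi : Integrable (G (t + 1)) (targetMeasure π₀ G t) :=
      integrable_of_abs_le hGm (B := max C 1) fun x => by rw [abs_of_pos (hpos x)]; exact hC' x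
    have hγ := integral_pos_of_pos hpos hi
    have hb' : 0 < min (1 / 2) b := lt_min (by norm_num) hb
    refine ⟨2 + 2 * ((2 + a) * Real.exp (min (1 / 2) b * c ^ 2)),
      min (1 / 8) (min (1 / 2) b / 9 *
        ((∫ x, G (t + 1) x ∂(targetMeasure π₀ G t)) / (4 * max C 1)) ^ 2),
      by positivity, lt_min (by norm_num) (by positivity), fun N hN => ?_⟩
    have hS := hX N hN
    have hpast := pastAlgebra_le hS.measurable_particles hS.measurable_jittered
      (show t ≤ T by omega)
    have h1 := (hab N hN).jitter hpast hN (hc N hN) (hS.measurable_jittered t ht)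
      (hS.jitter t ht) ha.le hb.le
    exact h1.resample (sup_le hpast (hS.measurable_jittered t ht).comap_le) hN hGm hpos hC0 hC'
      (hS.measurable_particles _ ht) (hS.resample t ht) hγ
      (integral_targetMeasure_succ hGm hpos) (by positivity)

/-! ### Functions on coordinate lines -/

theorem sum_smul_single {d : ℕ} (v : Vec d) :
    ∑ i, v i • EuclideanSpace.single i (1 : ℝ) = v := by
  ext j
  simp [Finset.sum_apply, Pi.single_apply]

theorem hasDerivAt_line {d : ℕ} {f : Vec d → ℝ} {v : Vec d}
    (hf : ∀ y, LineDifferentiableAt ℝ f y v) (x : Vec d) (t : ℝ) :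
    HasDerivAt (fun t : ℝ => f (x + t • v)) (lineDeriv ℝ f (x + t • v) v) t := by
  have h := (hf (x + t • v)).hasLineDerivAt
  unfold HasLineDerivAt at h
  have h1 : HasDerivAt (fun s : ℝ => s - t) 1 t := (hasDerivAt_id t).sub_const t
  rw [← sub_self t] at h
  have h2 := HasDerivAt.comp (h := fun s : ℝ => s - t) t h h1
  rw [mul_one] at h2
  refine h2.congr_of_eventuallyEq (Eventually.of_forall fun s => ?_)
  simp only [Function.comp, add_assoc, ← add_smul]
  congr 3
  ring

theorem multiIndexList_single {d : ℕ} (i : Fin d) : multiIndexList (Pi.single i 1) = [i] := by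
  have key : ∀ l : List (Fin d), l.Nodup →
      l.flatMap (fun j => List.replicate ((Pi.single i 1 : Fin d → ℕ) j) j) =
        if i ∈ l then [i] else [] := by
    intro l
    induction l with
    | nil => simp
    | cons j l ih =>
      intro h
      rw [List.flatMap_cons, ih h.of_cons]
      by_cases hij : i = j
      · subst hij
        simp [(List.nodup_cons.1 h).1]
      · have hji : j ≠ i := fun h => hij h.symm
        simp [hij, hji]
  rw [multiIndexList, key _ (List.nodup_finRange d)]
  simp

theorem multiDeriv_single {d : ℕ} (i : Fin d) (f : Vec d → ℝ) :
    multiDeriv (Pi.single i 1) f = partialDeriv i f := by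
  simp [multiDeriv, multiIndexList_single, mixedDeriv]

theorem lineDifferentiableAt_of_multiDerivExistsAt {d : ℕ} {i : Fin d} {f : Vec d → ℝ} {x : Vec d}
    (h : MultiDerivExistsAt (Pi.single i 1) f x) :
    LineDifferentiableAt ℝ f x (EuclideanSpace.single i 1) := by
  rw [MultiDerivExistsAt, multiIndexList_single] at h
  exact h.2

theorem multiDeriv_zero {d : ℕ} (f : Vec d → ℝ) : multiDeriv 0 f = f := by
  have : multiIndexList (0 : Fin d → ℕ) = [] := by simp [multiIndexList]
  simp [multiDeriv, this, mixedDeriv]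

theorem single_le_one {d : ℕ} (i j : Fin d) : (Pi.single i 1 : Fin d → ℕ) j ≤ 1 := by
  rw [Pi.single_apply]; split_ifs <;> simp

/-- A function that is Lipschitz along the coordinate lines is Lipschitz. -/
theorem abs_sub_le_of_coordinate {d : ℕ} {f : Vec d → ℝ} {C : ℝ} (hC : 0 ≤ C)
    (hf : ∀ (i : Fin d) (x : Vec d) (t : ℝ),
      |f (x + t • EuclideanSpace.single i 1) - f x| ≤ C * |t|) (x y : Vec d) :
    |f x - f y| ≤ C * d * ‖x - y‖ := by
  have key : ∀ s : Finset (Fin d),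
      |f (y + ∑ i ∈ s, (x - y) i • EuclideanSpace.single i (1 : ℝ)) - f y| ≤
        ∑ i ∈ s, C * ‖x - y‖ := by
    intro s
    induction s using Finset.induction_on with
    | empty => simp
    | insert i s hi ih =>
      rw [Finset.sum_insert hi, Finset.sum_insert hi, add_comm (_ • _) (Finset.sum _ _),
        ← add_assoc]
      refine (abs_sub_le _ (f (y + ∑ i ∈ s, (x - y) i • EuclideanSpace.single i (1 : ℝ))) _).trans
        (add_le_add ((hf _ _ _).trans ?_) ih)
      exact mul_le_mul_of_nonneg_left (PiLp.norm_apply_le (x - y) i) hC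
  have h := key Finset.univ
  rw [sum_smul_single, add_sub_cancel] at h
  refine h.trans (le_of_eq ?_)
  simp only [Finset.sum_const, Finset.card_univ, Fintype.card_fin, nsmul_eq_mul]
  ring

theorem IsSmoothingKernel.continuous {d : ℕ} {k : Vec d → ℝ} (hk : IsSmoothingKernel k) :
    Continuous k := by
  have := (hk.derivs 0 (by simp)).2.1
  rwa [multiDeriv_zero] at this

theorem IsSmoothingKernel.exists_bound {d : ℕ} {k : Vec d → ℝ} (hk : IsSmoothingKernel k) :
    ∃ C : ℝ, 0 < C ∧ ∀ u, |k u| ≤ C := by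
  obtain ⟨C, hC⟩ := (hk.derivs 0 (by simp)).2.2
  rw [multiDeriv_zero] at hC
  exact ⟨max C 1, lt_max_of_lt_right one_pos, fun u => (hC u).trans (le_max_left _ _)⟩

theorem IsSmoothingKernel.exists_lipschitz {d : ℕ} {k : Vec d → ℝ} (hk : IsSmoothingKernel k) :
    ∃ C : ℝ, 0 ≤ C ∧ ∀ u v, |k u - k v| ≤ C * ‖u - v‖ := by
  have h := fun i : Fin d => hk.derivs (Pi.single i 1) (single_le_one i)
  choose C hC using fun i => (h i).2.2
  have hC0 : ∀ i, 0 ≤ C i := fun i => (abs_nonneg _).trans (hC i 0)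
  have hsum : 0 ≤ ∑ i, C i := Finset.sum_nonneg fun i _ => hC0 i
  refine ⟨(∑ i, C i) * d, by positivity, abs_sub_le_of_coordinate hsum fun i x t => ?_⟩
  have hd := hasDerivAt_line (fun y => lineDifferentiableAt_of_multiDerivExistsAt ((h i).1 y)) x
  have hb := Convex.norm_image_sub_le_of_norm_hasDerivWithin_le (C := ∑ i, C i)
    (fun s _ => (hd s).hasDerivWithinAt) (fun s _ => ?_) convex_univ (Set.mem_univ 0)
    (Set.mem_univ t)
  · simpa using hb
  · have := hC i (x + s • EuclideanSpace.single i 1)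
    rw [multiDeriv_single] at this
    exact this.trans (Finset.single_le_sum (fun i _ => hC0 i) (Finset.mem_univ i))

theorem IsSmoothingKernel.integrable {d : ℕ} {k : Vec d → ℝ} (hk : IsSmoothingKernel k) :
    Integrable k := by
  by_contra h
  have := hk.integral_eq_one
  rw [integral_undef h] at this
  exact zero_ne_one this

theorem IsSmoothingKernel.integrable_first_moment {d : ℕ} {k : Vec d → ℝ}
    (hk : IsSmoothingKernel k) : Integrable fun u => k u * ‖u‖ := by
  refine (hk.integrable.add hk.second_moment).mono'
    (hk.continuous.mul continuous_norm).aestronglyMeasurable (ae_of_all _ fun u => ?_)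
  rw [Real.norm_eq_abs, abs_of_nonneg (mul_nonneg (hk.nonneg u) (norm_nonneg u))]
  simp only [Pi.add_apply]
  nlinarith [hk.nonneg u, sq_nonneg (‖u‖ - 1), norm_nonneg u,
    mul_nonneg (hk.nonneg u) (sq_nonneg (‖u‖ - 1)), mul_nonneg (hk.nonneg u) (sq_nonneg ‖u‖)]

/-! ### The density vanishes on the boundary and is Lipschitz on the whole space -/

/-- A function that is Lipschitz on `Θ`, vanishes off `Θ` and is continuous along the coordinate
lines is positive only at interior points of `Θ`. -/
theorem mem_interior_of_pos {d : ℕ} {Θ : Set (Vec d)} {f : Vec d → ℝ}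
    (h0 : ∀ x, x ∉ Θ → f x = 0)
    (hline : ∀ (i : Fin d) (x : Vec d),
      Continuous fun t : ℝ => f (x + t • EuclideanSpace.single i 1))
    {L : ℝ} (hL0 : 0 < L) (hL : ∀ x ∈ Θ, ∀ y ∈ Θ, |f x - f y| ≤ L * ‖x - y‖)
    {b : Vec d} (hpos : 0 < f b) : b ∈ interior Θ := by
  have hbΘ : b ∈ Θ := by
    by_contra h
    exact hpos.ne' (h0 b h)
  set ρ := f b / (2 * L * (d + 1)) with hρ
  have hρ0 : 0 < ρ := by positivity
  have hdich : ∀ z : Vec d, ‖z - b‖ ≤ d * ρ → f z = 0 ∨ f b / 2 ≤ f z := by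
    intro z hz
    by_cases hzΘ : z ∈ Θ
    · right
      have h1 := (abs_le.1 (hL z hzΘ b hbΘ)).1
      have h2 : L * ‖z - b‖ ≤ f b / 2 := by
        calc L * ‖z - b‖ ≤ L * ((d + 1) * ρ) := by gcongr; linarith
          _ = f b / 2 := by rw [hρ]; field_simp
      linarith
    · exact Or.inl (h0 z hzΘ)
  rw [mem_interior_iff_mem_nhds, Metric.mem_nhds_iff]
  refine ⟨ρ, hρ0, fun z hz => ?_⟩
  rw [Metric.mem_ball, dist_eq_norm] at hz
  have hnorm : ∀ (s : Finset (Fin d)) (c : Fin d → ℝ), (∀ i, |c i| ≤ 1) →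
      ‖∑ i ∈ s, (c i * (z - b) i) • EuclideanSpace.single i (1 : ℝ)‖ ≤ d * ρ := by
    intro s c hc
    calc _ ≤ ∑ i ∈ s, ρ := by
          refine norm_sum_le_of_le _ fun i _ => ?_
          rw [norm_smul, PiLp.norm_single, norm_one, mul_one, Real.norm_eq_abs, abs_mul]
          calc _ ≤ 1 * ‖z - b‖ :=
                mul_le_mul (hc i) (PiLp.norm_apply_le (z - b) i) (abs_nonneg _) zero_le_one
            _ ≤ ρ := by linarith
      _ = s.card * ρ := by simp
      _ ≤ d * ρ := by
          gcongr
          simpa using s.card_le_univ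
  have key : ∀ s : Finset (Fin d),
      f b / 2 ≤ f (b + ∑ i ∈ s, (z - b) i • EuclideanSpace.single i (1 : ℝ)) := by
    intro s
    induction s using Finset.induction_on with
    | empty => simp; linarith
    | insert i s hi ih =>
      set w := b + ∑ i ∈ s, (z - b) i • EuclideanSpace.single i (1 : ℝ) with hw
      have hpath : ∀ τ : ℝ, |τ| ≤ 1 →
          ‖w + (τ * (z - b) i) • EuclideanSpace.single i (1 : ℝ) - b‖ ≤ d * ρ := by
        intro τ hτ
        have h1 := hnorm (insert i s) (fun j => if j = i then τ else 1)
          (fun j => by split_ifs <;> simp [hτ])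
        rw [Finset.sum_insert hi] at h1
        have e : ∑ j ∈ s, ((if j = i then τ else 1) * (z - b) j) •
            EuclideanSpace.single j (1 : ℝ) =
            ∑ j ∈ s, (z - b) j • EuclideanSpace.single j (1 : ℝ) := by
          refine Finset.sum_congr rfl fun j hj => ?_
          rw [if_neg (ne_of_mem_of_not_mem hj hi), one_mul]
        rw [e, if_pos rfl] at h1
        convert h1 using 2
        rw [hw]
        abel
      have hcont : Continuous fun τ : ℝ =>
          f (w + (τ * (z - b) i) • EuclideanSpace.single i (1 : ℝ)) :=
        (hline i w).comp (continuous_id.mul continuous_const)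
      have hend : b + ∑ j ∈ insert i s, (z - b) j • EuclideanSpace.single j (1 : ℝ) =
          w + (1 * (z - b) i) • EuclideanSpace.single i (1 : ℝ) := by
        rw [Finset.sum_insert hi, hw, one_mul]; abel
      rw [hend]
      rcases hdich _ (hpath 1 (by simp)) with h1 | h1
      · exfalso
        have hmem : f b / 4 ∈ (fun τ : ℝ =>
            f (w + (τ * (z - b) i) • EuclideanSpace.single i (1 : ℝ))) '' Set.Icc 0 1 := by
          refine intermediate_value_Icc' zero_le_one hcont.continuousOn ⟨?_, ?_⟩
          · dsimp only; rw [h1]; linarith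
          · simp only [zero_mul, zero_smul, add_zero]; linarith
        obtain ⟨τ, hτ, hfτ⟩ := hmem
        dsimp only at hfτ
        rcases hdich _ (hpath τ (abs_le.2 ⟨by linarith [hτ.1], hτ.2⟩)) with h2 | h2 <;> linarith
      · exact h1
  have h := key Finset.univ
  rw [sum_smul_single, add_sub_cancel] at h
  by_contra hzΘ
  rw [h0 z hzΘ] at h
  linarith

theorem lipschitz_of_lipschitzDerivsOn {d : ℕ} {Θ : Set (Vec d)} (hΘ : IsClosed Θ)
    {f : Vec d → ℝ} (hf0 : ∀ x, 0 ≤ f x) (h0 : ∀ x, x ∉ Θ → f x = 0) (hf : LipschitzDerivsOn Θ f) :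
    ∃ L : ℝ, 0 < L ∧ ∀ x y, |f x - f y| ≤ L * ‖x - y‖ := by
  obtain ⟨L, hL0, hL⟩ := (hf 0 (by simp)).2
  rw [multiDeriv_zero] at hL
  have hline : ∀ (i : Fin d) (x : Vec d),
      Continuous fun t : ℝ => f (x + t • EuclideanSpace.single i 1) := by
    intro i x
    have hd : ∀ y, LineDifferentiableAt ℝ f y (EuclideanSpace.single i 1) := by
      intro y
      by_cases hy : y ∈ Θ
      · exact lineDifferentiableAt_of_multiDerivExistsAt
          ((hf (Pi.single i 1) (single_le_one i)).1 y hy)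
      · have hev : f =ᶠ[𝓝 y] fun _ => 0 := by
          filter_upwards [hΘ.isOpen_compl.mem_nhds hy] with z hz using h0 z hz
        exact hev.lineDifferentiableAt_iff.2 (differentiableAt_const _).lineDifferentiableAt
    exact continuous_iff_continuousAt.2 fun t => (hasDerivAt_line hd x t).continuousAt
  have hout : ∀ x ∈ Θ, ∀ y, y ∉ Θ → f x ≤ L * ‖x - y‖ := by
    intro x hx y hy
    rcases (hf0 x).eq_or_lt with hx0 | hx0
    · rw [← hx0]; positivity
    obtain ⟨b, hb, hbΘ, hbi⟩ : ∃ b ∈ segment ℝ x y, b ∈ Θ ∧ b ∉ interior Θ := by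
      by_contra! hcon
      have hsub : segment ℝ x y ⊆ interior Θ ∪ Θᶜ := fun b hb =>
        (em (b ∈ Θ)).imp (hcon b hb) id
      have hin := (convex_segment x y).isPreconnected.subset_left_of_subset_union isOpen_interior
        hΘ.isOpen_compl (disjoint_compl_right.mono_left interior_subset) hsub
        ⟨x, left_mem_segment ℝ x y, mem_interior_of_pos h0 hline hL0 hL hx0⟩
      exact hy (interior_subset (hin (right_mem_segment ℝ x y)))
    have hb0 : f b = 0 := by
      by_contra h
      exact hbi (mem_interior_of_pos h0 hline hL0 hL (lt_of_le_of_ne (hf0 b) (Ne.symm h)))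
    have h1 := (abs_le.1 (hL x hx b hbΘ)).2
    have h2 : ‖x - b‖ ≤ ‖x - y‖ := by
      have := norm_sub_le_of_mem_segment hb
      rw [norm_sub_rev, norm_sub_rev x y]
      exact this
    nlinarith
  refine ⟨L, hL0, fun x y => ?_⟩
  by_cases hx : x ∈ Θ <;> by_cases hy : y ∈ Θ
  · exact hL x hx y hy
  · rw [h0 y hy, sub_zero, abs_of_nonneg (hf0 x)]
    exact hout x hx y hy
  · rw [h0 x hx, zero_sub, abs_neg, abs_of_nonneg (hf0 y), norm_sub_rev]
    exact hout y hy x hx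
  · rw [h0 x hx, h0 y hy]
    simp; positivity

/-! ### The scaled kernel -/

theorem continuous_scaledKernel {d : ℕ} {k : Vec d → ℝ} (hk : Continuous k) (h : ℝ) :
    Continuous (scaledKernel k h) := by
  unfold scaledKernel
  fun_prop

theorem abs_scaledKernel_le {d : ℕ} {k : Vec d → ℝ} {K : ℝ} (hK : ∀ u, |k u| ≤ K) {h : ℝ}
    (hh : 0 < h) (u : Vec d) : |scaledKernel k h u| ≤ K * (h ^ d)⁻¹ := by
  rw [scaledKernel, abs_mul, abs_of_pos (by positivity), mul_comm]
  exact mul_le_mul_of_nonneg_right (hK _) (by positivity)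

theorem abs_scaledKernel_sub_le {d : ℕ} {k : Vec d → ℝ} {C : ℝ}
    (hC : ∀ u v, |k u - k v| ≤ C * ‖u - v‖) {h : ℝ} (hh : 0 < h) (u v : Vec d) :
    |scaledKernel k h u - scaledKernel k h v| ≤ C * (h ^ (d + 1))⁻¹ * ‖u - v‖ := by
  rw [scaledKernel, scaledKernel, ← mul_sub, abs_mul, abs_of_pos (by positivity)]
  calc _ ≤ (h ^ d)⁻¹ * (C * ‖h⁻¹ • u - h⁻¹ • v‖) := by gcongr; exact hC _ _
    _ = _ := by
      rw [← smul_sub, norm_smul, Real.norm_eq_abs, abs_of_pos (by positivity), pow_succ, mul_inv]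
      ring

theorem integral_scaledKernel_mul {d : ℕ} (k p : Vec d → ℝ) {h : ℝ} (hh : 0 < h) (θ : Vec d) :
    ∫ x, scaledKernel k h (θ - x) * p x = ∫ v, k v * p (θ - h • v) := by
  have h1 := integral_sub_left_eq_self (fun u => scaledKernel k h u * p (θ - u)) volume θ
  have h2 := Measure.integral_comp_inv_smul_of_nonneg (volume : Measure (Vec d))
    (fun v => k v * p (θ - h • v)) hh.le
  simp only [sub_sub_cancel] at h1
  simp only [smul_inv_smul₀ hh.ne', finrank_euclideanSpace, Fintype.card_fin, smul_eq_mul] at h2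
  rw [h1]
  simp only [scaledKernel, mul_assoc]
  rw [integral_const_mul, h2, inv_mul_cancel_left₀ (by positivity)]

/-- The bias of kernel smoothing of a Lipschitz function is of the order of the bandwidth. -/
theorem IsSmoothingKernel.abs_smoothing_sub_le {d : ℕ} {k : Vec d → ℝ} (hk : IsSmoothingKernel k)
    {p : Vec d → ℝ} {L : ℝ} (hL : ∀ x y, |p x - p y| ≤ L * ‖x - y‖) (hp : Measurable p)
    {h : ℝ} (hh : 0 < h) (θ : Vec d) :
    |(∫ x, scaledKernel k h (θ - x) * p x) - p θ| ≤ L * h * ∫ u, k u * ‖u‖ := by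
  have hle : ∀ v, |k v * (p (θ - h • v) - p θ)| ≤ L * h * (k v * ‖v‖) := by
    intro v
    rw [abs_mul, abs_of_nonneg (hk.nonneg v)]
    calc _ ≤ k v * (L * ‖θ - h • v - θ‖) := mul_le_mul_of_nonneg_left (hL _ _) (hk.nonneg v)
      _ = _ := by
        rw [sub_sub_cancel_left, norm_neg, norm_smul, Real.norm_eq_abs, abs_of_pos hh]; ring
  have hm : Integrable fun v => L * h * (k v * ‖v‖) := hk.integrable_first_moment.const_mul _
  have hmeas : Measurable fun v => k v * (p (θ - h • v) - p θ) :=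
    hk.continuous.measurable.mul ((hp.comp (by fun_prop)).sub_const _)
  have hi : Integrable fun v => k v * (p (θ - h • v) - p θ) :=
    hm.mono' hmeas.aestronglyMeasurable (ae_of_all _ hle)
  have hkp : ∫ v, k v * p (θ - h • v) = (∫ v, k v * (p (θ - h • v) - p θ)) + p θ := by
    have h1 := integral_add hi (hk.integrable.mul_const (p θ))
    rw [integral_mul_const, hk.integral_eq_one, one_mul] at h1
    rw [← h1]
    congr 1
    funext v
    ring
  rw [integral_scaledKernel_mul k p hh, hkp, add_sub_cancel_right]
  calc _ ≤ ∫ v, |k v * (p (θ - h • v) - p θ)| := abs_integral_le_integral_abs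
    _ ≤ ∫ v, L * h * (k v * ‖v‖) := integral_mono hi.abs hm hle
    _ = _ := integral_const_mul _ _

theorem IsPdfOf.integral_eq {d : ℕ} {Θ : Set (Vec d)} (hΘ : MeasurableSet Θ) {p : Vec d → ℝ}
    {π : Measure Θ} (hp : IsPdfOf p π) (f : Vec d → ℝ) :
    ∫ x : Θ, f x ∂π = ∫ x, f x * p x := by
  rw [← (MeasurableEmbedding.subtype_coe hΘ).integral_map f, hp.map_eq,
    integral_withDensity_eq_integral_toReal_smul hp.measurable.ennreal_ofReal
      (ae_of_all _ fun _ => ENNReal.ofReal_lt_top)]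
  simp only [ENNReal.toReal_ofReal (hp.nonneg _), smul_eq_mul, mul_comm]

theorem kde_eq_empiricalMean {d : ℕ} {Θ : Set (Vec d)} {k : Vec d → ℝ} (hk : Continuous k) {N : ℕ}
    (x : Fin N → Θ) (θ : Vec d) :
    kde k x θ =
      empiricalMean (fun θ' : Θ => scaledKernel k (bandwidth d N) (θ - (θ' : Vec d))) x := by
  have hm : StronglyMeasurable
      fun θ' : Θ => scaledKernel k (bandwidth d N) (θ - (θ' : Vec d)) :=
    ((continuous_scaledKernel hk _).comp (by fun_prop)).measurable.stronglyMeasurable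
  rw [kde, empiricalMeasure, integral_smul_measure, integral_finsetSum_measure]
  · simp only [integral_dirac' _ _ hm, empiricalMean, smul_eq_mul]
    simp
  · intro i _
    exact integrable_dirac' hm (by simp)

theorem abs_empiricalMean_sub_le {S : Type*} {N : ℕ} {φ ψ : S → ℝ} {C : ℝ} (hC0 : 0 ≤ C)
    (h : ∀ x, |φ x - ψ x| ≤ C) (x : Fin N → S) :
    |empiricalMean φ x - empiricalMean ψ x| ≤ C := by
  rw [empiricalMean, empiricalMean, ← mul_sub, ← Finset.sum_sub_distrib, abs_mul,
    abs_of_nonneg (by positivity)]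
  calc _ ≤ (N : ℝ)⁻¹ * ∑ _i : Fin N, C := by
        gcongr
        exact (Finset.abs_sum_le_sum_abs _ _).trans (Finset.sum_le_sum fun i _ => h _)
    _ = ((N : ℝ)⁻¹ * N) * C := by simp [mul_assoc]
    _ ≤ 1 * C := by gcongr; exact inv_mul_le_one
    _ = C := one_mul C

/-! ### The bandwidth -/

theorem bandwidth_inv_le {d N : ℕ} :
    (bandwidth d N)⁻¹ ≤ (N : ℝ) ^ (1 / (2 * ((d : ℝ) + 1))) := by
  rw [bandwidth, inv_inv]
  exact Int.floor_le _

theorem one_le_floor_rpow {d N : ℕ} (hN : 1 ≤ N) :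
    (1 : ℝ) ≤ ((⌊(N : ℝ) ^ (1 / (2 * ((d : ℝ) + 1)))⌋ : ℤ) : ℝ) := by
  have h1 : (1 : ℝ) ≤ (N : ℝ) ^ (1 / (2 * ((d : ℝ) + 1))) :=
    Real.one_le_rpow (by exact_mod_cast hN) (by positivity)
  exact_mod_cast Int.le_floor.2 (by exact_mod_cast h1)

theorem bandwidth_pos {d N : ℕ} (hN : 1 ≤ N) : 0 < bandwidth d N :=
  inv_pos.2 (zero_lt_one.trans_le (one_le_floor_rpow hN))

theorem bandwidth_le {d N : ℕ} (hN : 1 ≤ N) :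
    bandwidth d N ≤ 2 * (N : ℝ) ^ (-(1 / (2 * ((d : ℝ) + 1)))) := by
  have hN0 : (0 : ℝ) < N := by exact_mod_cast hN
  have h1 := one_le_floor_rpow (d := d) hN
  have h2 := Int.lt_floor_add_one ((N : ℝ) ^ (1 / (2 * ((d : ℝ) + 1))))
  have h3 : 0 < (N : ℝ) ^ (1 / (2 * ((d : ℝ) + 1))) := Real.rpow_pos_of_pos hN0 _
  rw [bandwidth, Real.rpow_neg hN0.le, ← div_eq_mul_inv, inv_eq_one_div,
    div_le_div_iff₀ (by linarith) h3]
  linarith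

theorem bandwidth_pow_inv_le {d N : ℕ} (hN : 1 ≤ N) (n : ℕ) :
    (bandwidth d N ^ n)⁻¹ ≤ (N : ℝ) ^ (1 / (2 * ((d : ℝ) + 1)) * n) := by
  rw [← inv_pow, Real.rpow_mul N.cast_nonneg, Real.rpow_natCast]
  exact pow_le_pow_left₀ (inv_nonneg.2 (bandwidth_pos hN).le) bandwidth_inv_le n

/-! ### A grid of mesh `1 / N` -/

/-- The multi-indices of the grid points in the cube `[-R, R]^d`. -/
noncomputable def gridIndices (d R N : ℕ) : Finset (Fin d → ℤ) :=
  Fintype.piFinset fun _ => Finset.Icc (-((R * N : ℕ) : ℤ)) ((R * N : ℕ) : ℤ)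

/-- The grid point with a given multi-index. -/
noncomputable def gridPoint (N : ℕ) {d : ℕ} (j : Fin d → ℤ) : Vec d :=
  WithLp.toLp 2 fun i => (j i : ℝ) / N

theorem card_gridIndices (d R N : ℕ) : (gridIndices d R N).card = (2 * (R * N) + 1) ^ d := by
  simp only [gridIndices, Fintype.card_piFinset_const, Int.card_Icc]
  congr 1
  omega

theorem norm_le_of_abs_apply_le {d : ℕ} {v : Vec d} {c : ℝ} (h : ∀ i, |v i| ≤ c) :
    ‖v‖ ≤ d * c := by
  rw [← sum_smul_single v]
  calc _ ≤ ∑ _i : Fin d, c := norm_sum_le_of_le _ fun i _ => by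
        simpa [norm_smul] using h i
    _ = d * c := by simp

theorem exists_gridPoint_near {d R N : ℕ} (hN : 1 ≤ N) {θ : Vec d} (hθ : ‖θ‖ ≤ R) :
    ∃ j ∈ gridIndices d R N, ‖θ - gridPoint N j‖ ≤ d / N := by
  have hN0 : (0 : ℝ) < N := by exact_mod_cast hN
  have hθi : ∀ i, |θ i| ≤ R := fun i => (PiLp.norm_apply_le θ i).trans hθ
  refine ⟨fun i => ⌊θ i * N⌋, ?_, ?_⟩
  · rw [gridIndices, Fintype.mem_piFinset]
    intro i
    have hi := abs_le.1 (hθi i)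
    rw [Finset.mem_Icc]
    constructor
    · rw [Int.le_floor]
      push_cast
      nlinarith
    · rw [← Int.cast_le (R := ℝ)]
      refine (Int.floor_le _).trans ?_
      push_cast
      nlinarith
  · rw [div_eq_mul_inv]
    refine norm_le_of_abs_apply_le fun i => ?_
    have h1 := Int.floor_le (θ i * N)
    have h2 := Int.lt_floor_add_one (θ i * N)
    have e : (θ - gridPoint N fun i => ⌊θ i * N⌋) i = (θ i * N - ⌊θ i * N⌋) * (N : ℝ)⁻¹ := by
      simp only [gridPoint, PiLp.sub_apply]
      field_simp
    rw [e, abs_mul, abs_of_pos (inv_pos.2 hN0)]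
    refine mul_le_of_le_one_left (inv_pos.2 hN0).le (abs_le.2 ⟨by linarith, by linarith⟩)

theorem summable_grid_tail (d R : ℕ) {c γ : ℝ} (hc : 0 < c) (hγ : 0 < γ) :
    Summable fun N : ℕ =>
      ((2 * (R * (N + 1 : ℕ)) + 1 : ℕ) : ℝ) ^ d * Real.exp (-c * ((N + 1 : ℕ) : ℝ) ^ γ) := by
  rw [summable_nat_add_iff 1
    (f := fun N : ℕ => ((2 * (R * N) + 1 : ℕ) : ℝ) ^ d * Real.exp (-c * (N : ℝ) ^ γ))]
  refine summable_of_isBigO_nat (g := fun N : ℕ => (N : ℝ) ^ (-2 : ℝ))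
    (Real.summable_nat_rpow.2 (by norm_num)) ?_
  have h1 : (fun N : ℕ => Real.exp (-c * (N : ℝ) ^ γ)) =O[atTop]
      fun N : ℕ => ((N : ℝ) ^ γ) ^ (-(d + 2) / γ) :=
    ((isLittleO_exp_neg_mul_rpow_atTop hc (-(d + 2) / γ)).comp_tendsto
      ((tendsto_rpow_atTop hγ).comp tendsto_natCast_atTop_atTop)).isBigO
  have h2 : (fun N : ℕ => ((2 * (R * N) + 1 : ℕ) : ℝ) ^ d) =O[atTop]
      fun N : ℕ => (N : ℝ) ^ d := by
    refine Asymptotics.IsBigO.pow ?_ d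
    refine Asymptotics.IsBigO.of_bound (2 * R + 1) ?_
    filter_upwards [eventually_ge_atTop 1] with N hN
    have hN1 : (1 : ℝ) ≤ N := by exact_mod_cast hN
    rw [Real.norm_of_nonneg (by positivity), Real.norm_of_nonneg (by positivity)]
    push_cast
    nlinarith
  refine (h2.mul h1).congr' EventuallyEq.rfl ?_
  filter_upwards [eventually_ge_atTop 1] with N hN
  have hN0 : (0 : ℝ) < N := by exact_mod_cast hN
  rw [← Real.rpow_mul hN0.le, ← Real.rpow_natCast, ← Real.rpow_add hN0]
  congr 1
  field_simp
  ring

/-! ### The uniform rate -/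

/-- The error of the kernel density estimator at `θ` with respect to its limit under `π`. -/
noncomputable def stochasticError {d : ℕ} {Θ : Set (Vec d)} (k : Vec d → ℝ) (π : Measure Θ) {N : ℕ}
    (x : Fin N → Θ) (θ : Vec d) : ℝ :=
  |kde k x θ - ∫ θ' : Θ, scaledKernel k (bandwidth d N) (θ - (θ' : Vec d)) ∂π|

theorem rpow_half_eq {d N : ℕ} (hN : 1 ≤ N) :
    (N : ℝ) ^ (1 / (2 * ((d : ℝ) + 1)) * ((d + 1 : ℕ) : ℝ)) * (N : ℝ)⁻¹ ≤
      (N : ℝ) ^ (-(1 / (2 * ((d : ℝ) + 1)))) := by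
  have hN1 : (1 : ℝ) ≤ N := by exact_mod_cast hN
  rw [← Real.rpow_neg_one, ← Real.rpow_add (by linarith)]
  apply Real.rpow_le_rpow_of_exponent_le hN1
  push_cast
  rw [← sub_nonneg]
  have : -(1 / (2 * ((d : ℝ) + 1))) - (1 / (2 * ((d : ℝ) + 1)) * ((d : ℝ) + 1) + -1) =
      d / (2 * (d + 1)) := by field_simp; ring
  rw [this]
  positivity

/-- Away from the grid the error is controlled by the error on the grid, the Lipschitz constant of
the kernel and the bias. -/
theorem exists_error_le {d : ℕ} {Θ : Set (Vec d)} (hΘ : IsCompact Θ) {k : Vec d → ℝ}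
    (hk : IsSmoothingKernel k) {p : Vec d → ℝ} {π : Measure Θ} [IsProbabilityMeasure π]
    (hp : IsPdfOf p π) (hpL : LipschitzDerivsOn Θ p) :
    ∃ (C : ℝ) (R : ℕ), 0 ≤ C ∧ ∀ N, 1 ≤ N → ∀ (x : Fin N → Θ), ∀ θ ∈ Θ,
      ∃ j ∈ gridIndices d R N, |kde k x θ - p θ| ≤
        stochasticError k π x (gridPoint N j) +
          C * (N : ℝ) ^ (-(1 / (2 * ((d : ℝ) + 1)))) := by
  obtain ⟨L, hL0, hL⟩ := lipschitz_of_lipschitzDerivsOn hΘ.isClosed hp.nonneg hp.eq_zero hpL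
  obtain ⟨Λ, hΛ0, hΛ⟩ := hk.exists_lipschitz
  obtain ⟨K, hK0, hK⟩ := hk.exists_bound
  obtain ⟨r, hr⟩ := hΘ.isBounded.exists_norm_le
  obtain ⟨R, hR⟩ := exists_nat_ge r
  set M := ∫ u, k u * ‖u‖ with hM
  have hM0 : 0 ≤ M := integral_nonneg fun u => mul_nonneg (hk.nonneg u) (norm_nonneg u)
  refine ⟨2 * (Λ * d) + L * 2 * M, R, by positivity, fun N hN x θ hθ => ?_⟩
  obtain ⟨j, hj, hjθ⟩ := exists_gridPoint_near hN ((hr θ hθ).trans hR)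
  refine ⟨j, hj, ?_⟩
  set η := gridPoint N j
  set h := bandwidth d N with hh
  set ρ := (N : ℝ) ^ (-(1 / (2 * ((d : ℝ) + 1)))) with hρ
  have hh0 : 0 < h := bandwidth_pos hN
  have hN0 : (0 : ℝ) < N := by exact_mod_cast hN
  have hclose : ∀ y : Vec d,
      |scaledKernel k h (θ - y) - scaledKernel k h (η - y)| ≤ Λ * d * ρ := by
    intro y
    calc _ ≤ Λ * (h ^ (d + 1))⁻¹ * ‖(θ - y) - (η - y)‖ := abs_scaledKernel_sub_le hΛ hh0 _ _
      _ ≤ Λ * (N : ℝ) ^ (1 / (2 * ((d : ℝ) + 1)) * ((d + 1 : ℕ) : ℝ)) * (d / N) := by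
          rw [sub_sub_sub_cancel_right]
          gcongr
          exact bandwidth_pow_inv_le hN (d + 1)
      _ = Λ * d * ((N : ℝ) ^ (1 / (2 * ((d : ℝ) + 1)) * ((d + 1 : ℕ) : ℝ)) * (N : ℝ)⁻¹) := by
          rw [div_eq_mul_inv]; ring
      _ ≤ _ := by gcongr; exact rpow_half_eq hN
  have h1 : |kde k x θ - kde k x η| ≤ Λ * d * ρ := by
    rw [kde_eq_empiricalMean hk.continuous, kde_eq_empiricalMean hk.continuous]
    exact abs_empiricalMean_sub_le (φ := fun y : Θ => scaledKernel k h (θ - y))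
      (ψ := fun y : Θ => scaledKernel k h (η - y)) (C := Λ * d * ρ) (by positivity)
      (fun y => hclose y) x
  have hint : ∀ ζ : Vec d, Integrable (fun θ' : Θ => scaledKernel k h (ζ - (θ' : Vec d))) π :=
    fun ζ => integrable_of_abs_le
      ((continuous_scaledKernel hk.continuous _).comp (by fun_prop)).measurable
      fun y => abs_scaledKernel_le hK hh0 _
  have h2 : |∫ θ' : Θ, scaledKernel k h (η - (θ' : Vec d)) ∂π -
      ∫ θ' : Θ, scaledKernel k h (θ - (θ' : Vec d)) ∂π| ≤ Λ * d * ρ := by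
    rw [← integral_sub (hint η) (hint θ)]
    have h := norm_integral_le_of_norm_le_const (μ := π) (C := Λ * d * ρ)
      (f := fun y : Θ => scaledKernel k h (η - y) - scaledKernel k h (θ - y))
      (ae_of_all _ fun y => by
        rw [Real.norm_eq_abs, abs_sub_comm]
        exact hclose y)
    rwa [probReal_univ, mul_one] at h
  have h3 : |(∫ θ' : Θ, scaledKernel k h (θ - (θ' : Vec d)) ∂π) - p θ| ≤ L * 2 * M * ρ := by
    rw [hp.integral_eq hΘ.measurableSet fun y => scaledKernel k h (θ - y)]
    refine (hk.abs_smoothing_sub_le hL hp.measurable hh0 θ).trans ?_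
    have := bandwidth_le (d := d) hN
    calc L * h * M ≤ L * (2 * ρ) * M := by gcongr
      _ = _ := by ring
  have h4 := abs_sub_le (kde k x θ) (kde k x η) (p θ)
  have h5 := abs_sub_le (kde k x η) (∫ θ' : Θ, scaledKernel k h (η - (θ' : Vec d)) ∂π) (p θ)
  have h6 := abs_sub_le (∫ θ' : Θ, scaledKernel k h (η - (θ' : Vec d)) ∂π)
    (∫ θ' : Θ, scaledKernel k h (θ - (θ' : Vec d)) ∂π) (p θ)
  rw [stochasticError]
  linarith

/-- The probability that the error is large at some grid point. -/
theorem Concentrates.measureReal_grid_le {Ω : Type*} [MeasurableSpace Ω] {μ : Measure Ω}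
    [IsProbabilityMeasure μ] {d : ℕ} {Θ : Set (Vec d)} {k : Vec d → ℝ} (hk : Continuous k) {K : ℝ}
    (hK0 : 0 < K) (hK : ∀ u, |k u| ≤ K) {π : Measure Θ} {a b : ℝ} {N : ℕ} (hN : 1 ≤ N)
    {Y : Ω → Fin N → Θ} (hY : Concentrates μ Y π a b) (R : ℕ) (ε : ℝ) :
    μ.real (⋃ j ∈ gridIndices d R N,
      {ω | (N : ℝ) ^ (-((1 - ε) / (2 * ((d : ℝ) + 1)))) ≤
        stochasticError k π (Y ω) (gridPoint N j)}) ≤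
      a * (((2 * (R * N) + 1 : ℕ) : ℝ) ^ d *
        Real.exp (-(b / K ^ 2) * (N : ℝ) ^ (ε / ((d : ℝ) + 1)))) := by
  have hN0 : (0 : ℝ) < N := by exact_mod_cast hN
  set q := 1 / (2 * ((d : ℝ) + 1)) with hq
  set B := K * (N : ℝ) ^ (q * d) with hB
  have hB0 : 0 < B := by positivity
  set s := (N : ℝ) ^ (-((1 - ε) / (2 * ((d : ℝ) + 1))) - q * d) / K with hs
  have hsB : s * B = (N : ℝ) ^ (-((1 - ε) / (2 * ((d : ℝ) + 1)))) := by
    rw [hs, hB, Real.rpow_sub hN0]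
    field_simp
  have hNs : b * N * s ^ 2 = b / K ^ 2 * (N : ℝ) ^ (ε / ((d : ℝ) + 1)) := by
    have e : (N : ℝ) ^ (ε / ((d : ℝ) + 1)) =
        N * ((N : ℝ) ^ (-((1 - ε) / (2 * ((d : ℝ) + 1))) - q * d)) ^ 2 := by
      conv_rhs => rw [← Real.rpow_natCast, ← Real.rpow_mul hN0.le]
      nth_rw 2 [← Real.rpow_one (N : ℝ)]
      rw [← Real.rpow_add hN0]
      congr 1
      rw [hq]
      push_cast
      field_simp
      ring
    rw [e, hs, div_pow]
    ring
  have hj : ∀ j : Fin d → ℤ, μ.real {ω | (N : ℝ) ^ (-((1 - ε) / (2 * ((d : ℝ) + 1)))) ≤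
        stochasticError k π (Y ω) (gridPoint N j)} ≤
      a * Real.exp (-(b / K ^ 2) * (N : ℝ) ^ (ε / ((d : ℝ) + 1))) := by
    intro j
    have h1 := hY (fun θ' : Θ => scaledKernel k (bandwidth d N) (gridPoint N j - (θ' : Vec d)))
      ((continuous_scaledKernel hk _).comp (by fun_prop)).measurable B hB0
      (fun y => (abs_scaledKernel_le hK (bandwidth_pos hN) _).trans
        (mul_le_mul_of_nonneg_left (bandwidth_pow_inv_le hN d) hK0.le)) s (by positivity)
    rw [hsB, hNs, ← neg_mul] at h1
    simpa only [stochasticError, kde_eq_empiricalMean hk] using h1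
  calc _ ≤ ∑ j ∈ gridIndices d R N, _ := measureReal_biUnion_finset_le _ _
    _ ≤ ∑ _j ∈ gridIndices d R N, _ := Finset.sum_le_sum fun j _ => hj j
    _ = _ := by
      rw [Finset.sum_const, card_gridIndices, nsmul_eq_mul]
      push_cast
      ring

theorem measurable_stochasticError {Ω : Type*} [MeasurableSpace Ω] {d : ℕ} {Θ : Set (Vec d)}
    {k : Vec d → ℝ} (hk : Continuous k) (π : Measure Θ) {N : ℕ} {Y : Ω → Fin N → Θ}
    (hY : Measurable Y) (θ : Vec d) : Measurable fun ω => stochasticError k π (Y ω) θ := by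
  simp only [stochasticError, kde_eq_empiricalMean hk]
  exact (((measurable_empiricalMean ((continuous_scaledKernel hk _).comp
    (by fun_prop)).measurable).comp hY).sub_const _).abs

/-- A sequence of finite random variables whose exceedance probabilities are summable has an almost
surely finite supremum. -/
theorem ae_iSup_lt_top {Ω : Type*} [MeasurableSpace Ω] {μ : Measure Ω} {W : ℕ → Ω → ℝ≥0∞}
    (hW : ∀ N ω, W N ω < ∞) {A : ℕ → Set Ω} (hA : ∑' N, μ (A N) ≠ ∞) {c : ℝ≥0∞} (hc : c < ∞)
    (hWA : ∀ N ω, ω ∉ A N → W N ω ≤ c) : ∀ᵐ ω ∂μ, ⨆ N, W N ω < ∞ := by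
  filter_upwards [ae_eventually_notMem hA] with ω hω
  obtain ⟨n, hn⟩ := eventually_atTop.1 hω
  have hfin : ∑ N ∈ Finset.range n, W N ω + c < ∞ :=
    ENNReal.add_lt_top.2 ⟨ENNReal.sum_lt_top.2 fun N _ => hW N ω, hc⟩
  refine (iSup_le fun N => ?_).trans_lt hfin
  rcases lt_or_ge N n with h | h
  · exact (Finset.single_le_sum (f := fun N => W N ω) (fun _ _ => zero_le)
      (Finset.mem_range.2 h)).trans le_self_add
  · exact (hWA N ω (hn N h)).trans le_add_self

theorem exists_uniform_rate {Ω : Type*} [MeasurableSpace Ω] {μ : Measure Ω}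
    [IsProbabilityMeasure μ] {d : ℕ} {Θ : Set (Vec d)} (hΘ : IsCompact Θ) {k : Vec d → ℝ}
    (hk : IsSmoothingKernel k) {p : Vec d → ℝ} {π : Measure Θ} [IsProbabilityMeasure π]
    (hp : IsPdfOf p π) (hpL : LipschitzDerivsOn Θ p) {Y : (N : ℕ) → Ω → Fin N → Θ}
    (hYm : ∀ N, 1 ≤ N → Measurable (Y N)) {a b : ℝ} (hb : 0 < b)
    (hY : ∀ N, 1 ≤ N → Concentrates μ (Y N) π a b) {ε : ℝ} (hε0 : 0 < ε) (hε1 : ε < 1) :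
    ∃ V : Ω → ℝ≥0∞, Measurable V ∧ (∀ᵐ ω ∂μ, V ω < ∞) ∧
      ∀ ω, ∀ N : ℕ, 1 ≤ N → supDist Θ (kde k (Y N ω)) p ≤
        V ω / ENNReal.ofReal ((N : ℝ) ^ ((1 - ε) / (2 * ((d : ℝ) + 1)))) := by
  obtain ⟨C, R, hC0, hC⟩ := exists_error_le hΘ hk hp hpL
  obtain ⟨K, hK0, hK⟩ := hk.exists_bound
  set r : ℕ → ℝ := fun N => (N : ℝ) ^ ((1 - ε) / (2 * ((d : ℝ) + 1))) with hr
  have hr0 : ∀ N, 1 ≤ N → 0 < r N := fun N hN =>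
    Real.rpow_pos_of_pos (by exact_mod_cast hN) _
  let W : ℕ → Ω → ℝ≥0∞ := fun N ω => ENNReal.ofReal (r N) *
    ((⨆ j ∈ gridIndices d R N, ENNReal.ofReal (stochasticError k π (Y N ω) (gridPoint N j))) +
      ENNReal.ofReal (C * (N : ℝ) ^ (-(1 / (2 * ((d : ℝ) + 1))))))
  refine ⟨fun ω => ⨆ N, W (N + 1) ω, ?_, ?_, fun ω N hN => ?_⟩
  · refine Measurable.iSup fun N => Measurable.const_mul (Measurable.add_const ?_ _) _
    exact Measurable.iSup fun j => Measurable.iSup fun _ =>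
      (measurable_stochasticError hk.continuous π (hYm _ (by omega)) _).ennreal_ofReal
  · refine ae_iSup_lt_top (c := ENNReal.ofReal (1 + C)) (A := fun N => ⋃ j ∈ gridIndices d R (N + 1),
      {ω | ((N + 1 : ℕ) : ℝ) ^ (-((1 - ε) / (2 * ((d : ℝ) + 1)))) ≤
        stochasticError k π (Y (N + 1) ω) (gridPoint (N + 1) j)}) (fun N ω => ?_) ?_
      ENNReal.ofReal_lt_top fun N ω hω => ?_
    · refine ENNReal.mul_lt_top ENNReal.ofReal_lt_top
        (ENNReal.add_lt_top.2 ⟨?_, ENNReal.ofReal_lt_top⟩)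
      rw [← Finset.sup_eq_iSup, Finset.sup_lt_iff ENNReal.zero_lt_top]
      exact fun j _ => ENNReal.ofReal_lt_top
    · have hsum := ((summable_grid_tail d R (c := b / K ^ 2) (γ := ε / ((d : ℝ) + 1))
        (by positivity) (by positivity)).mul_left a).tsum_ofReal_ne_top
      refine ne_top_of_le_ne_top hsum (ENNReal.tsum_le_tsum fun N => ?_)
      rw [← ofReal_measureReal (measure_ne_top _ _)]
      exact ENNReal.ofReal_le_ofReal
        ((hY (N + 1) (by omega)).measureReal_grid_le hk.continuous hK0 hK (by omega) R ε)
    · have hN1 : (1 : ℝ) ≤ (N + 1 : ℕ) := by exact_mod_cast Nat.le_add_left 1 N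
      have hN0 : (0 : ℝ) < (N + 1 : ℕ) := by linarith
      simp only [Set.mem_iUnion, Set.mem_ofPred_eq, not_exists, not_le] at hω
      have h1 : (⨆ j ∈ gridIndices d R (N + 1),
          ENNReal.ofReal (stochasticError k π (Y (N + 1) ω) (gridPoint (N + 1) j))) ≤
          ENNReal.ofReal ((r (N + 1))⁻¹) := by
        refine iSup₂_le fun j hj => ENNReal.ofReal_le_ofReal ?_
        rw [hr]
        dsimp only
        rw [← Real.rpow_neg hN0.le]
        exact (hω j hj).le
      have h2 : ((N + 1 : ℕ) : ℝ) ^ (-(1 / (2 * ((d : ℝ) + 1)))) ≤ (r (N + 1))⁻¹ := by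
        rw [hr]
        dsimp only
        rw [← Real.rpow_neg hN0.le]
        apply Real.rpow_le_rpow_of_exponent_le hN1
        gcongr
        linarith
      have hrN := hr0 (N + 1) (by omega)
      calc W (N + 1) ω ≤ ENNReal.ofReal (r (N + 1)) *
            (ENNReal.ofReal ((r (N + 1))⁻¹) + ENNReal.ofReal (C * (r (N + 1))⁻¹)) := by
            dsimp only [W]
            gcongr
        _ = ENNReal.ofReal (1 + C) := by
            rw [← ENNReal.ofReal_add (by positivity) (by positivity),
              ← ENNReal.ofReal_mul hrN.le]
            congr 1
            field_simp
  · rw [ENNReal.le_div_iff_mul_le (Or.inl (ENNReal.ofReal_pos.2 (hr0 N hN)).ne')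
      (Or.inl ENNReal.ofReal_ne_top), mul_comm]
    have hVW : W N ω ≤ ⨆ N, W (N + 1) ω := by
      have := le_iSup (fun N => W (N + 1) ω) (N - 1)
      rwa [Nat.sub_add_cancel hN] at this
    refine le_trans (mul_le_mul_right ?_ _) hVW
    refine iSup₂_le fun θ hθ => ?_
    obtain ⟨j, hj, hjθ⟩ := hC N hN (Y N ω) θ hθ
    refine (ENNReal.ofReal_le_ofReal hjθ).trans (ENNReal.ofReal_add_le.trans ?_)
    gcongr
    exact le_iSup₂ (f := fun j _ =>
      ENNReal.ofReal (stochasticError k π (Y N ω) (gridPoint N j))) j hj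

theorem tendsto_zero_of_le_div {f : ℕ → ℝ≥0∞} {v : ℝ≥0∞} (hv : v < ∞) {e : ℝ} (he : 0 < e)
    (h : ∀ N : ℕ, 1 ≤ N → f N ≤ v / ENNReal.ofReal ((N : ℝ) ^ e)) :
    Tendsto f atTop (𝓝 0) := by
  have h1 : Tendsto (fun N : ℕ => v / ENNReal.ofReal ((N : ℝ) ^ e)) atTop (𝓝 (v / ∞)) :=
    ENNReal.Tendsto.const_div (ENNReal.tendsto_ofReal_atTop.comp
      ((tendsto_rpow_atTop he).comp tendsto_natCast_atTop_atTop)) (Or.inr hv.ne)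
  rw [ENNReal.div_top] at h1
  refine tendsto_of_tendsto_of_tendsto_of_le_of_le' tendsto_const_nhds h1
    (Eventually.of_forall fun _ => zero_le) ?_
  filter_upwards [eventually_ge_atTop 1] with N hN using h N hN

end ParticleKDE


theorem mainTheorem3 {d : ℕ} (Θ : Set (ParticleKDE.Vec d)) (hΘ : IsCompact Θ)
    (T : ℕ) (π₀ : Measure Θ) [IsProbabilityMeasure π₀]
    (G : ℕ → Θ → ℝ) (hG : ParticleKDE.PositiveBoundedPotentials G T)
    (p : ℕ → ParticleKDE.Vec d → ℝ)
    (hp : ∀ t, 1 ≤ t → t ≤ T → ParticleKDE.IsPdfOf (p t) (ParticleKDE.targetMeasure π₀ G t))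
    (hpL : ∀ t, 1 ≤ t → t ≤ T → ParticleKDE.LipschitzDerivsOn Θ (p t))
    (k : ParticleKDE.Vec d → ℝ) (hk : ParticleKDE.IsSmoothingKernel k)
    (κ : ℕ → Kernel Θ Θ) [∀ N, IsMarkovKernel (κ N)] (hκ : ParticleKDE.JitteringBound κ)
    {Ω : Type*} [MeasurableSpace Ω] (μ : Measure Ω) [IsProbabilityMeasure μ]
    (X Xhat : (N : ℕ) → ℕ → Ω → Fin N → Θ)
    (hX : ∀ N, 1 ≤ N → ParticleKDE.IsParticleSystem μ π₀ (κ N) G T (X N) (Xhat N)) :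
    ∀ t, 1 ≤ t → t ≤ T →
      (∀ ε : ℝ, 0 < ε → ε < 1 →
        ∃ V : Ω → ℝ≥0∞, Measurable V ∧ (∀ᵐ ω ∂μ, V ω < ∞) ∧
          ∀ ω, ∀ N : ℕ, 1 ≤ N →
            ParticleKDE.supDist Θ (ParticleKDE.kde k (X N t ω)) (p t) ≤
              V ω / ENNReal.ofReal ((N : ℝ) ^ ((1 - ε) / (2 * ((d : ℝ) + 1))))) ∧
      ∀ᵐ ω ∂μ, Tendsto
        (fun N : ℕ => ParticleKDE.supDist Θ (ParticleKDE.kde k (X N t ω)) (p t)) atTop (𝓝 0) := by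
  intro t ht1 htT
  obtain ⟨a, b, -, hb, hab⟩ := ParticleKDE.exists_concentrates hG hκ hX htT
  have := ParticleKDE.isProbabilityMeasure_targetMeasure (π₀ := π₀) hG htT
  have hrate := fun (ε : ℝ) (hε0 : 0 < ε) (hε1 : ε < 1) =>
    ParticleKDE.exists_uniform_rate hΘ hk (hp t ht1 htT) (hpL t ht1 htT)
      (fun N hN => (hX N hN).measurable_particles t htT) hb hab hε0 hε1
  refine ⟨hrate, ?_⟩
  obtain ⟨V, -, hV, hle⟩ := hrate (1 / 2) (by norm_num) (by norm_num)
  filter_upwards [hV] with ω hω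
  exact ParticleKDE.tendsto_zero_of_le_div hω
    (div_pos (by norm_num : (0 : ℝ) < 1 - 1 / 2) (by positivity)) (hle ω)
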